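/- **Setting.** Let $R=\mathbb{Z}[x]$ and $F=\mathbb{Q}(x)$ its field of fractions. Let $\mathscr{A}_n$ be the Temperley--Lieb algebra over $F$: the unital associative $F$-algebra generated by $e_1,\dots,e_{n-1}$ with relations $e_i^2=xe_i$, $e_ie_{i\pm1}e_i=e_i$, and $e_ie_j=e_je_i$ for $|i-j|\ge2$. Define $p_0=0$, $p_1=1$, $p_{i+1}=xp_i-p_{i-1}$. A *partition* of $n$ is a pair $\lambda=(f,n-2f)$ with $0\le 2f\le n$; write $(f,n-2f)\rhd(g,n-2g)$ if $f>g$. For a partition $\mu$ of $k-1$ and a partition $(i,k-2i)$ of $k$, write $\mu\to(i,k-2i)$ if $\mu=(i,k-2i-1)$ or $\mu=(i-1,k-2i+1)$. Let $\mathfrak{T}_n(\lambda)$ be the set of sequences $\mathfrak{t}=(\lambda^{(0)},\dots,\lambda^{(n)})$ with $\lambda^{(0)}=(0,0)$, $\lambda^{(k-1)}\to\lambda^{(k)}$ for $1\le k\le n$, and $\lambda^{(n)}=\lambda$. Write $\mathrm{Shape}(\mathfrak{t}|_k)=\lambda^{(k)}$ and let $\mathfrak{t}^{(k)}$ be the one-row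 diagram with $k-2i$ boxes if $\lambda^{(k)}=(i,k-2i)$. For $\mathfrak{s},\mathfrak{t}\in\mathfrak{T}_n(\lambda)$ write $\mathfrak{t}\rhd\mathfrak{s}$ if $\mathfrak{t}\ne\mathfrak{s}$ and, for $k=1,\dots,n$, the first entry of $\mathrm{Shape}(\mathfrak{t}|_k)$ is at least that of $\mathrm{Shape}(\mathfrak{s}|_k)$. For $\lambda=(f,n-2f)$ put $m_\lambda=e_1e_3\cdots e_{2f-1}$, let $\check{\mathscr{A}}^\lambda$ be the two-sided ideal generated by the $m_\mu$ with $\mu$ a partition of $n$, $\mu\rhd\lambda$, and let $C^\lambda$ be the right submodule of $\mathscr{A}_n/\check{\mathscr{A}}^\lambda$ generated by the class of $m_\lambda$. For $\mathfrak{t}\in\mathfrak{T}_n(\lambda)$ define $v_{\mathfrak{t}|_0}=1$ and, if $\mathrm{Shape}(\mathfrak{t}|_k)=(i,k-2i)$, $v_{\mathfrak{t}|_k}=v_{\mathfrak{t}|_{k-1}}$ when $\mathrm{Shape}(\mathfrak{t}|_{k-1})=(i,k-2i-1)$ and $v_{\mathfrak{t}|_k}=e_{2i}e_{2i+1}\cdots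 e_{k-1}\,v_{\mathfrak{t}|_{k-1}}$ when $\mathrm{Shape}(\mathfrak{t}|_{k-1})=(i-1,k-2i+1)$. Put $v_{\mathfrak t}=v_{\mathfrak{t}|_n}$ and $m_\mathfrak{t}=m_\lambda v_{\mathfrak{t}}+\check{\mathscr{A}}^\lambda\in C^\lambda$. Define $T_0=T_1=0$, $T_2=e_1$ and $T_{i+1}=-e_iT_i-T_ie_i+e_ie_{i-1}T_ie_i-z_{i-1}-e_iz_{i-2}$ for $i\ge2$, where $z_i=\sum_{k=0}^ix^kT_{i-k}$. For $\mathfrak{t}\in\mathfrak{T}_n(\lambda)$ put $r_\mathfrak{t}(0)=r_\mathfrak{t}(1)=0$ and, for $2\le k\le n$ with $\mathrm{Shape}(\mathfrak{t}|_k)=(i,k-2i)$, $$r_\mathfrak{t}(k)=\begin{cases}(p_i-xp_{i-1})p_{k-i+1},&\mathrm{Shape}(\mathfrak{t}|_{k-1})=(i-1,k-2i+1),\\(p_{k-i+1}-xp_{k-i})p_i,&\mathrm{Shape}(\mathfrak{t}|_{k-1})=(i,k-2i-1),\end{cases}$$ and $z_\mathfrak{t}(k)=\sum_{i=0}^kx^ir_\mathfrak{t}(k-i)$.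 Let $\mathfrak{R}(k)$ be the set of all $r_\mathfrak{u}(k)$ with $\mathfrak{u}\in\mathfrak{T}_k(\mu)$, $\mu$ a partition of $k$, and let $$f_\mathfrak{t}=m_\mathfrak{t}\prod_{k=2}^n\ \prod_{r\in\mathfrak{R}(k),\,r\ne r_\mathfrak{t}(k)}\frac{T_k-r}{r_\mathfrak{t}(k)-r}.$$ **Statement.** Let $\lambda$ be a partition of $n$. Then $\{f_\mathfrak{t}:\mathfrak{t}\in\mathfrak{T}_n(\lambda)\}$ is an $F$-basis of $C^\lambda$, so for $1\le k<n$ elements $e_k(\mathfrak{s},\mathfrak{t})\in F$ are determined by $f_\mathfrak{t}e_k=\sum_{\mathfrak{s}\in\mathfrak{T}_n(\lambda)}e_k(\mathfrak{s},\mathfrak{t})f_\mathfrak{s}$. For $\mathfrak{s},\mathfrak{t}\in\mathfrak{T}_n(\lambda)$: 1. if $e_k(\mathfrak{s},\mathfrak{t})\ne0$, then $\mathrm{Shape}(\mathfrak{s}|_j)=\mathrm{Shape}(\mathfrak{t}|_j)$ for all $0\le j\le n$ with $j\ne k$, and $r_\mathfrak{s}(j)=r_\mathfrak{t}(j)$ for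 all $0\le j\le n$ with $j\notin\{k,k+1\}$; 2. if $e_k(\mathfrak{s},\mathfrak{t})\ne0$, then $\mathfrak{t}^{(k-1)}=\mathfrak{t}^{(k+1)}$ and $\mathfrak{s}^{(k-1)}=\mathfrak{s}^{(k+1)}$; 3. if $e_k(\mathfrak{s},\mathfrak{t})\ne0$ and $\mathfrak{s}\ne\mathfrak{t}$, then $e_k(\mathfrak{u},\mathfrak{t})=0$ for all $\mathfrak{u}\in\mathfrak{T}_n(\lambda)\setminus\{\mathfrak{s},\mathfrak{t}\}$; 4. if $\mathfrak{t}\rhd\mathfrak{s}$ and $e_k(\mathfrak{s},\mathfrak{t})\ne0$, then $e_k(\mathfrak{s},\mathfrak{t})=1$, $e_k(\mathfrak{t},\mathfrak{s})=e_k(\mathfrak{s},\mathfrak{s})\,e_k(\mathfrak{t},\mathfrak{t})$, $$e_k(\mathfrak{t},\mathfrak{t})=\frac{r_\mathfrak{t}(k+1)+z_\mathfrak{t}(k-1)}{p_k-xz_\mathfrak{t}(k-1)-2r_\mathfrak{t}(k)},\qquad e_k(\mathfrak{s},\mathfrak{s})=\frac{r_\mathfrak{s}(k+1)+z_\mathfrak{s}(k-1)}{p_k-xz_\mathfrak{s}(k-1)-2r_\mathfrak{s}(k)},$$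 and, if $\mathrm{Shape}(\mathfrak{t}|_k)=(i,k-2i)$, $$e_k(\mathfrak{t},\mathfrak{t})=\frac{p_{k-2i+1}}{p_{k-2i+2}},\qquad e_k(\mathfrak{s},\mathfrak{s})=\frac{p_{k-2i+3}}{p_{k-2i+2}};$$ 5. if $\mathfrak{t}\rhd\mathfrak{s}$, $\mathrm{Shape}(\mathfrak{s}|_j)=\mathrm{Shape}(\mathfrak{t}|_j)$ for all $j\ne k$, and $\mathfrak{t}^{(k-1)}=\mathfrak{t}^{(k+1)}$, then $e_k(\mathfrak{s},\mathfrak{t})\ne0$ (so item 4 applies). -/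

import Mathlib

open Polynomial

noncomputable section

namespace TemperleyLieb

/-! ### The Temperley–Lieb algebra -/

/-- Indices of the generators `e_1, …, e_{n-1}`. -/
abbrev GenIdx (n : ℕ) : Type := {i : ℕ // 1 ≤ i ∧ i < n}

/-- The defining relations of the Temperley–Lieb algebra on `e_1, …, e_{n-1}` with parameter `x`. -/
inductive Rel (S : Type) [CommRing S] (x : S) (n : ℕ) :
    FreeAlgebra S (GenIdx n) → FreeAlgebra S (GenIdx n) → Prop
  | sq (i : GenIdx n) :
      Rel S x n (FreeAlgebra.ι S i * FreeAlgebra.ι S i) (x • FreeAlgebra.ι S i)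
  | adjacent (i j : GenIdx n) (h : i.1 + 1 = j.1 ∨ j.1 + 1 = i.1) :
      Rel S x n (FreeAlgebra.ι S i * FreeAlgebra.ι S j * FreeAlgebra.ι S i) (FreeAlgebra.ι S i)
  | distant (i j : GenIdx n) (h : i.1 + 2 ≤ j.1 ∨ j.1 + 2 ≤ i.1) :
      Rel S x n (FreeAlgebra.ι S i * FreeAlgebra.ι S j) (FreeAlgebra.ι S j * FreeAlgebra.ι S i)

/-- The Temperley–Lieb algebra on `n` strands over `S` with parameter `x`: the unital associative
`S`-algebra presented by `e_1, …, e_{n-1}` and the relations `Rel`. -/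
abbrev TL (S : Type) [CommRing S] (x : S) (n : ℕ) : Type := RingQuot (Rel S x n)

/-- The generator `e_i`, for `1 ≤ i < n` (and `0` for the indices outside this range, which are
never used). -/
def e {S : Type} [CommRing S] (x : S) (n i : ℕ) : TL S x n :=
  if h : 1 ≤ i ∧ i < n then RingQuot.mkAlgHom S (Rel S x n) (FreeAlgebra.ι S ⟨i, h⟩) else 0

/-! ### Partitions and tableaux -/

/-- The partitions of `n` are the pairs `(i, n - 2i)` with `0 ≤ 2i ≤ n`. -/
def partitions (n : ℕ) : Finset (ℕ × ℕ) :=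
  (Finset.range (n / 2 + 1)).image fun i => (i, n - 2 * i)

/-- `μ → λ`: with `λ = (i, j)`, either `μ = (i, j - 1)` or `μ = (i - 1, j + 1)`. -/
def Arrow (mu lam : ℕ × ℕ) : Prop :=
  (mu.1 = lam.1 ∧ mu.2 + 1 = lam.2) ∨ (mu.1 + 1 = lam.1 ∧ mu.2 = lam.2 + 1)

/-- The set `𝔗_n(λ)` of tableaux `(λ⁽⁰⁾, …, λ⁽ⁿ⁾)` with `λ⁽⁰⁾ = (0,0)`, `λ⁽ᵏ⁻¹⁾ → λ⁽ᵏ⁾` and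
`λ⁽ⁿ⁾ = λ`. -/
@[ext]
structure Tableau (n : ℕ) (lam : ℕ × ℕ) where
  seq : Fin (n + 1) → ℕ × ℕ
  seq_zero : seq 0 = (0, 0)
  seq_step : ∀ k : Fin n, Arrow (seq k.castSucc) (seq k.succ)
  seq_last : seq (Fin.last n) = lam

/-- The shape `λ⁽ᵏ⁾` of `𝔱|_k`, for `k ≤ n` (indices `k > n` are never used). -/
def Tableau.shape {n : ℕ} {lam : ℕ × ℕ} (t : Tableau n lam) (k : ℕ) : ℕ × ℕ :=
  t.seq ⟨min k n, by omega⟩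

theorem Tableau.seq_weight {n : ℕ} {lam : ℕ × ℕ} (t : Tableau n lam) (k : Fin (n + 1)) :
    2 * (t.seq k).1 + (t.seq k).2 = k.1 := by
  induction k using Fin.induction with
  | zero => simp [t.seq_zero]
  | succ k ih =>
    have h := t.seq_step k
    simp only [Fin.val_castSucc] at ih
    rcases h with h | h <;> simp only [Fin.val_succ] <;> omega

instance Tableau.instFinite (n : ℕ) (lam : ℕ × ℕ) : Finite (Tableau n lam) := by
  refine Finite.of_injective
    (fun (t : Tableau n lam) (k : Fin (n + 1)) =>
      ((⟨(t.seq k).1, by have := t.seq_weight k; omega⟩,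
        ⟨(t.seq k).2, by have := t.seq_weight k; omega⟩) : Fin (n + 1) × Fin (n + 1))) ?_
  intro s t h
  ext1
  funext k
  have hk := congrFun h k
  simp only [Prod.mk.injEq, Fin.mk.injEq] at hk
  exact Prod.ext hk.1 hk.2

instance Tableau.instFintype (n : ℕ) (lam : ℕ × ℕ) : Fintype (Tableau n lam) := Fintype.ofFinite _

/-- `𝔰 ⊵ 𝔱`: the shape of `𝔰|_k` dominates that of `𝔱|_k` for `k = 1, …, n`. -/
def Tableau.Dominates {n : ℕ} {lam : ℕ × ℕ} (s t : Tableau n lam) : Prop :=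
  ∀ k, 1 ≤ k → k ≤ n → (t.shape k).1 ≤ (s.shape k).1

/-- `𝔰 ▷ 𝔱`. -/
def Tableau.StrictlyDominates {n : ℕ} {lam : ℕ × ℕ} (s t : Tableau n lam) : Prop :=
  s.Dominates t ∧ s ≠ t

/-- The number of boxes of `𝔱⁽ᵏ⁾`, where `𝔱` is viewed as an up-down tableau of one-row diagrams:
`k - 2i` boxes when `λ⁽ᵏ⁾ = (i, k - 2i)`. -/
def Tableau.boxes {n : ℕ} {lam : ℕ × ℕ} (t : Tableau n lam) (k : ℕ) : ℕ := (t.shape k).2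

/-! ### The Murphy basis of the cell modules -/

/-- `e_i e_{i+1} ⋯ e_{j-1}` (equal to `1` if `j ≤ i`). -/
def w {S : Type} [CommRing S] (x : S) (n i j : ℕ) : TL S x n :=
  ((List.range' i (j - i)).map (e x n)).prod

/-- `m_λ = e_1 e_3 ⋯ e_{2f-1}` for `λ = (f, n - 2f)`. -/
def mPart {S : Type} [CommRing S] (x : S) (n : ℕ) (lam : ℕ × ℕ) : TL S x n :=
  ((List.range lam.1).map fun j => e x n (2 * j + 1)).prod

/-- The element `v_{𝔱|_k}`. -/
def vRestr {S : Type} [CommRing S] (x : S) {n : ℕ} {lam : ℕ × ℕ} (t : Tableau n lam) :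
    ℕ → TL S x n
  | 0 => 1
  | k + 1 =>
    if (t.shape k).1 = (t.shape (k + 1)).1 then vRestr x t k
    else w x n (2 * (t.shape (k + 1)).1) (k + 1) * vRestr x t k

/-- The two-sided ideal `Ǎ_n^λ` generated by the `m_μ` with `μ ▷ λ`. -/
def higherIdeal {S : Type} [CommRing S] (x : S) (n : ℕ) (lam : ℕ × ℕ) : TwoSidedIdeal (TL S x n) :=
  TwoSidedIdeal.span {a | ∃ mu ∈ partitions n, lam.1 < mu.1 ∧ a = mPart x n mu}

/-- The quotient of the Temperley–Lieb algebra by `Ǎ_n^λ`. -/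
abbrev TLQuot {S : Type} [CommRing S] (x : S) (n : ℕ) (lam : ℕ × ℕ) : Type :=
  (higherIdeal x n lam).ringCon.Quotient

/-- The quotient map. The right action of the algebra on its quotient (and on the cell module) is
right multiplication by the image under this map. -/
def toQuot {S : Type} [CommRing S] (x : S) (n : ℕ) (lam : ℕ × ℕ) : TL S x n →+* TLQuot x n lam :=
  (higherIdeal x n lam).ringCon.mk'

/-- The cell module `C^λ`: the right submodule of the quotient generated by the class of `m_λ`. -/
def cellModule {S : Type} [CommRing S] (x : S) (n : ℕ) (lam : ℕ × ℕ) :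
    Submodule S (TLQuot x n lam) :=
  LinearMap.range (LinearMap.mulLeft S (toQuot x n lam (mPart x n lam)))

/-- The Murphy basis element `m_𝔱 = m_λ v_𝔱 + Ǎ_n^λ` of `C^λ`. -/
def mTab {S : Type} [CommRing S] (x : S) {n : ℕ} {lam : ℕ × ℕ} (t : Tableau n lam) :
    TLQuot x n lam :=
  toQuot x n lam (mPart x n lam * vRestr x t n)

/-! ### Jucys–Murphy elements and their eigenvalues -/

/-- The Jucys–Murphy elements: `T_0 = T_1 = 0`, `T_2 = e_1` and, for `i ≥ 2`,
`T_{i+1} = - e_i T_i - T_i e_i + e_i e_{i-1} T_i e_i - z_{i-1} - e_i z_{i-2}`, where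
`z_i = ∑_{k=0}^{i} x^k T_{i-k}`. -/
def jm {S : Type} [CommRing S] (x : S) (n : ℕ) : ℕ → TL S x n
  | 0 => 0
  | 1 => 0
  | 2 => e x n 1
  | i + 3 =>
    - (e x n (i + 2) * jm x n (i + 2)) - jm x n (i + 2) * e x n (i + 2)
      + e x n (i + 2) * e x n (i + 1) * jm x n (i + 2) * e x n (i + 2)
      - ∑ k : Fin (i + 2), x ^ (k : ℕ) • jm x n (i + 1 - k)
      - e x n (i + 2) * ∑ k : Fin (i + 1), x ^ (k : ℕ) • jm x n (i - k)
  termination_by i => i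
  decreasing_by all_goals omega

/-- `p_0 = 0`, `p_1 = 1`, `p_{i+1} = x p_i - p_{i-1}`. -/
def p {S : Type} [CommRing S] (x : S) : ℕ → S
  | 0 => 0
  | 1 => 1
  | i + 2 => x * p x (i + 1) - p x i

/-- `r_𝔱(k)`. With `λ⁽ᵏ⁾ = (i, k - 2i)` the first case of the definition is
`λ⁽ᵏ⁻¹⁾ = (i - 1, k - 2i + 1)`, the second is `λ⁽ᵏ⁻¹⁾ = (i, k - 2i - 1)`. -/
def r {S : Type} [CommRing S] (x : S) {n : ℕ} {lam : ℕ × ℕ} (t : Tableau n lam) (k : ℕ) : S :=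
  if k < 2 then 0
  else
    let i := (t.shape k).1
    if (t.shape (k - 1)).1 + 1 = i then (p x i - x * p x (i - 1)) * p x (k - i + 1)
    else (p x (k - i + 1) - x * p x (k - i)) * p x i

/-- `z_𝔱(k) = ∑_{i=0}^{k} x^i r_𝔱(k - i)`. -/
def z {S : Type} [CommRing S] (x : S) {n : ℕ} {lam : ℕ × ℕ} (t : Tableau n lam) (k : ℕ) : S :=
  ∑ i ∈ Finset.range (k + 1), x ^ i * r x t (k - i)

/-! ### The seminormal basis -/

open Classical in
/-- `ℜ(k)`: the set of all `r_𝔱(k)` with `𝔱 ∈ 𝔗_k(μ)` and `μ` a partition of `k`. -/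
def contents {K : Type} [Field K] (x : K) (k : ℕ) : Finset K :=
  (partitions k).biUnion fun mu => Finset.univ.image fun t : Tableau k mu => r x t k

open Classical in
/-- `F_𝔱 = ∏_{k=2}^{n} ∏_{r ∈ ℜ(k), r ≠ r_𝔱(k)} (T_k - r) / (r_𝔱(k) - r)`. The inner product is a
polynomial evaluated at `T_k`; the outer product is taken in the order `k = 2, …, n` (the elements
`T_k` commute). -/
def idem {K : Type} [Field K] (x : K) {n : ℕ} {lam : ℕ × ℕ} (t : Tableau n lam) : TL K x n :=
  ((List.range' 2 (n - 1)).map fun k =>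
    aeval (jm x n k)
      (∏ c ∈ (contents x k).erase (r x t k), (C (r x t k - c)⁻¹ * (X - C c) : K[X]))).prod

/-- The seminormal basis element `f_𝔱 = m_𝔱 F_𝔱`. -/
def fTab {K : Type} [Field K] (x : K) {n : ℕ} {lam : ℕ × ℕ} (t : Tableau n lam) :
    TLQuot x n lam :=
  mTab x t * toQuot x n lam (idem x t)

/-! ### The generic parameter -/

/-- The field of fractions of `ℤ[x]`. -/
abbrev FracField : Type := FractionRing ℤ[X]

/-- The indeterminate `x`, as an element of the field of fractions of `ℤ[x]`. -/
def gx : FracField := algebraMap ℤ[X] FracField X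

end TemperleyLieb

end

/-! A tableau is a lattice path, recorded by its numbers of boxes (its heights). The expected
matrices of the `e_k` are written down in advance and shown to define a representation; the elements
`f_t` are then matched with its coordinates.

On functions of tableaux, `seminormalOp` lets `e_k` act as follows. It vanishes at paths that do not
turn at `k`; on the at most two paths that agree off `k` with a given path turning there, a peak and
a valley over height h, it has rank one and trace (p_{h+2} + p_h) / p_{h+1} = x. The Temperley–Lieb
relations hold once all p_j with j ≥ 1 are nonzero (`seminormalOp_sq`, `seminormalOp_adjacent`,
`seminormalOp_distant`), which gives `seminormalRep`. It is a left action on functions, dual to the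
right action on the cell module.

In this representation T_k is diagonal with eigenvalues r_t(k) (`seminormalRep_jm_apply`). These
separate tableaux, because going up and going down from one shape give eigenvalues differing by
p_{h+1} ≠ 0. Hence the product F_t acts as the projection onto the coordinate t
(`seminormalRep_idem_apply`).

The link with the cell module is evaluation at the most dominant tableau: a ↦ (a φ)(top). It kills
the ideal of higher shapes (`seminormalRep_eq_zero_of_mem`) and sends m_λ v_t F_t to x^f φ(t)
(`seminormalRep_murphy_apply`). Varying φ shows that the f_t are independent and reads off
coefficients: f_t e_k goes to x^f (e_k φ)(t), so the matrix entries sought are those of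
`seminormalOp`. Spanning is a dimension count: reduction of words shows that the m_t span the cell
module (`cellModule_le_span`), and there are as many f_t as m_t.

The formulas of item 4 then come from identities among the p_i: both eigenvalues at a turn, and z_t,
have closed forms in the shape at level k - 1. -/

noncomputable section
namespace TemperleyLieb

/-! ### Identities for the polynomials `p_i` -/

section Polynomials

variable {S : Type} [CommRing S] (x : S)

theorem p_zero : p x 0 = 0 := rfl
theorem p_one : p x 1 = 1 := rfl
theorem p_add_two (i : ℕ) : p x (i + 2) = x * p x (i + 1) - p x i := rfl
theorem p_two : p x 2 = x := by rw [p_add_two, p_zero, zero_add, p_one]; ring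

/-- The left side is unchanged when a grows by one, and at a = 0 it is p_d. -/
theorem p_mul_sub_mul (a d : ℕ) :
    p x (a + 1) * p x (a + d) - p x a * p x (a + d + 1) = p x d := by
  induction a with
  | zero => simp [p_zero, p_one]
  | succ a ih =>
    rw [← ih, show a + 1 + d = a + d + 1 by ring, p_add_two, p_add_two]
    ring

/-- Moving one unit from a to c leaves the left side unchanged; this is the addition formula for
Chebyshev polynomials. -/
theorem p_mul_add_mul (a c : ℕ) :
    p x (a + 1) * p x (c + 1) - p x a * p x c = p x (a + c + 1) := by
  induction a generalizing c with
  | zero => simp [p_zero, p_one]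
  | succ a ih =>
    rw [show a + 1 + c + 1 = a + (c + 1) + 1 by ring, ← ih (c + 1), p_add_two x a, p_add_two x c]
    ring

theorem map_p {S' : Type} [CommRing S'] (g : S →+* S') (i : ℕ) : g (p x i) = p (g x) i := by
  induction i using Nat.twoStepInduction with
  | zero => simp [p_zero]
  | one => simp [p_one]
  | more i h₀ h₁ => rw [p_add_two, p_add_two, map_sub, map_mul, h₀, h₁]

end Polynomials

theorem p_two_int (i : ℕ) : p (2 : ℤ) i = i := by
  induction i using Nat.twoStepInduction with
  | zero => rfl
  | one => rfl
  | more i h₀ h₁ => rw [p_add_two, h₀, h₁]; push_cast; ring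

/-- Specialising x to 2 turns p_i into i. This is the only property of the generic parameter that
the proof needs. -/
theorem p_gx_ne_zero (j : ℕ) : p gx (j + 1) ≠ 0 := by
  rw [gx, ← map_p]
  intro h
  have h0 : p (X : ℤ[X]) (j + 1) = 0 :=
    (IsFractionRing.injective ℤ[X] FracField) (by rw [h, map_zero])
  have h1 := map_p (X : ℤ[X]) (Polynomial.evalRingHom (2 : ℤ)) (j + 1)
  rw [h0, map_zero, Polynomial.coe_evalRingHom, eval_X, p_two_int] at h1
  omega

/-! ### Tableaux as lattice paths -/

namespace Tableau

variable {n : ℕ} {lam : ℕ × ℕ}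

theorem shape_eq (t : Tableau n lam) {k : ℕ} (hk : k ≤ n) :
    t.shape k = t.seq ⟨k, by omega⟩ := by
  unfold shape
  congr 2
  omega

theorem shape_weight (t : Tableau n lam) {k : ℕ} (hk : k ≤ n) :
    2 * (t.shape k).1 + t.boxes k = k := by
  rw [boxes, shape_eq t hk]
  exact t.seq_weight _

theorem shape_self (t : Tableau n lam) : t.shape n = lam := by
  rw [shape_eq t le_rfl]
  exact t.seq_last

theorem boxes_self (t : Tableau n lam) : t.boxes n = lam.2 := by rw [boxes, shape_self]

theorem boxes_zero (t : Tableau n lam) : t.boxes 0 = 0 := by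
  have := t.shape_weight (Nat.zero_le n)
  omega

theorem boxes_step (t : Tableau n lam) {k : ℕ} (hk : k < n) :
    t.boxes (k + 1) = t.boxes k + 1 ∨ t.boxes k = t.boxes (k + 1) + 1 := by
  have h := t.seq_step ⟨k, hk⟩
  have h1 : t.shape k = t.seq (Fin.castSucc ⟨k, hk⟩) := shape_eq t hk.le
  have h2 : t.shape (k + 1) = t.seq (Fin.succ ⟨k, hk⟩) := shape_eq t hk
  unfold boxes
  rw [h1, h2]
  rcases h with h | h <;> omega

theorem boxes_one (t : Tableau n lam) (hn : 1 ≤ n) : t.boxes 1 = 1 := by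
  have h0 := t.boxes_zero
  have := t.boxes_step (k := 0) hn
  simp only [zero_add] at this
  omega

theorem lam_weight (t : Tableau n lam) : 2 * lam.1 + lam.2 = n := by
  have := t.shape_weight le_rfl
  rwa [boxes, shape_self] at this

theorem shape_eq_of_boxes {s t : Tableau n lam} {k : ℕ} (hk : k ≤ n)
    (h : s.boxes k = t.boxes k) : s.shape k = t.shape k := by
  have h1 := s.shape_weight hk
  have h2 := t.shape_weight hk
  exact Prod.ext (by omega) h

theorem ext_boxes {s t : Tableau n lam} (h : ∀ k ≤ n, s.boxes k = t.boxes k) : s = t := by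
  ext1
  funext k
  have hk : k.1 ≤ n := by omega
  have := shape_eq_of_boxes hk (h k hk)
  rwa [shape_eq s hk, shape_eq t hk] at this

/-- The tableau whose diagrams have the prescribed numbers of boxes. -/
def ofBoxes (b : ℕ → ℕ) (h0 : b 0 = 0)
    (hs : ∀ k < n, b (k + 1) = b k + 1 ∨ b k = b (k + 1) + 1)
    (hb : b n = lam.2) (hlam : 2 * lam.1 + lam.2 = n) : Tableau n lam :=
  have key : ∀ k ≤ n, 2 * ((k - b k) / 2) + b k = k := by
    intro k
    induction k with
    | zero => omega
    | succ k ih =>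
      intro hk
      have := ih (by omega)
      rcases hs k (by omega) with h | h <;> omega
  { seq := fun k => ((k.1 - b k.1) / 2, b k.1)
    seq_zero := by simp [h0]
    seq_step := by
      intro k
      have h1 := key k.1 (by omega)
      have h2 := key (k.1 + 1) (by omega)
      simp only [Arrow, Fin.val_castSucc, Fin.val_succ]
      rcases hs k.1 (by omega) with h | h <;> omega
    seq_last := by
      have h1 := key n le_rfl
      simp only [Fin.val_last]
      exact Prod.ext (by simp only; omega) hb }

theorem boxes_ofBoxes (b : ℕ → ℕ) (h0 : b 0 = 0)
    (hs : ∀ k < n, b (k + 1) = b k + 1 ∨ b k = b (k + 1) + 1)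
    (hb : b n = lam.2) (hlam : 2 * lam.1 + lam.2 = n) {k : ℕ} (hk : k ≤ n) :
    (ofBoxes b h0 hs hb hlam).boxes k = b k := by
  rw [boxes, shape_eq _ hk]
  rfl

open Classical in
/-- The tableau obtained by putting `v` boxes at level `k`, if there is one (and `t` otherwise). -/
def setBoxes (t : Tableau n lam) (k v : ℕ) : Tableau n lam :=
  if h : ∃ s : Tableau n lam, ∀ j ≤ n, s.boxes j = Function.update t.boxes k v j then h.choose
  else t

theorem boxes_setBoxes (t : Tableau n lam) {k v : ℕ} (hk : 1 ≤ k) (hkn : k < n)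
    (h1 : v = t.boxes (k - 1) + 1 ∨ t.boxes (k - 1) = v + 1)
    (h2 : v = t.boxes (k + 1) + 1 ∨ t.boxes (k + 1) = v + 1) {j : ℕ} (hj : j ≤ n) :
    (t.setBoxes k v).boxes j = if j = k then v else t.boxes j := by
  have h : ∃ s : Tableau n lam, ∀ j ≤ n, s.boxes j = Function.update t.boxes k v j := by
    refine ⟨ofBoxes (Function.update t.boxes k v) ?_ ?_ ?_ t.lam_weight, fun j hj =>
      boxes_ofBoxes _ _ _ _ _ hj⟩
    · rw [Function.update_of_ne (by omega), boxes_zero]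
    · intro j hj
      by_cases e1 : j = k
      · subst e1
        rw [Function.update_self, Function.update_of_ne (by omega)]
        omega
      · by_cases e2 : j + 1 = k
        · subst e2
          rw [Function.update_self, Function.update_of_ne (by omega)]
          simpa using h1
        · rw [Function.update_of_ne e1, Function.update_of_ne e2]
          exact t.boxes_step hj
    · rw [Function.update_of_ne (by omega), boxes_self]
  rw [setBoxes, dif_pos h, h.choose_spec j hj, Function.update_apply]

/-- `t` turns at level `k`: its diagrams at levels `k - 1` and `k + 1` agree. -/
def Turns (t : Tableau n lam) (k : ℕ) : Prop := t.boxes (k - 1) = t.boxes (k + 1)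

instance (t : Tableau n lam) (k : ℕ) : Decidable (t.Turns k) := by unfold Turns; infer_instance

/-- The tableau with a peak at level `k` agreeing with `t` at all other levels. -/
def peak (t : Tableau n lam) (k : ℕ) : Tableau n lam := t.setBoxes k (t.boxes (k - 1) + 1)

/-- The tableau with a valley at level `k` agreeing with `t` at all other levels, when there is
one. -/
def valley (t : Tableau n lam) (k : ℕ) : Tableau n lam := t.setBoxes k (t.boxes (k - 1) - 1)

variable {t : Tableau n lam} {k : ℕ}

theorem boxes_peak (hk : 1 ≤ k) (hkn : k < n) (ht : t.Turns k) {j : ℕ} (hj : j ≤ n) :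
    (t.peak k).boxes j = if j = k then t.boxes (k - 1) + 1 else t.boxes j := by
  unfold Turns at ht
  exact boxes_setBoxes t hk hkn (by omega) (by omega) hj

theorem boxes_valley (hk : 1 ≤ k) (hkn : k < n) (ht : t.Turns k) (h : t.boxes (k - 1) ≠ 0)
    {j : ℕ} (hj : j ≤ n) :
    (t.valley k).boxes j = if j = k then t.boxes (k - 1) - 1 else t.boxes j := by
  unfold Turns at ht
  exact boxes_setBoxes t hk hkn (by omega) (by omega) hj

theorem boxes_peak_self (hk : 1 ≤ k) (hkn : k < n) (ht : t.Turns k) :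
    (t.peak k).boxes k = t.boxes (k - 1) + 1 := by
  rw [boxes_peak hk hkn ht hkn.le, if_pos rfl]

theorem boxes_peak_of_ne (hk : 1 ≤ k) (hkn : k < n) (ht : t.Turns k) {j : ℕ} (hj : j ≤ n)
    (hjk : j ≠ k) : (t.peak k).boxes j = t.boxes j := by
  rw [boxes_peak hk hkn ht hj, if_neg hjk]

theorem boxes_valley_self (hk : 1 ≤ k) (hkn : k < n) (ht : t.Turns k)
    (h : t.boxes (k - 1) ≠ 0) : (t.valley k).boxes k = t.boxes (k - 1) - 1 := by
  rw [boxes_valley hk hkn ht h hkn.le, if_pos rfl]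

theorem boxes_valley_of_ne (hk : 1 ≤ k) (hkn : k < n) (ht : t.Turns k)
    (h : t.boxes (k - 1) ≠ 0) {j : ℕ} (hj : j ≤ n) (hjk : j ≠ k) :
    (t.valley k).boxes j = t.boxes j := by
  rw [boxes_valley hk hkn ht h hj, if_neg hjk]

theorem eq_of_boxes_of_ne {s t : Tableau n lam} (k : ℕ) (h : ∀ j ≤ n, j ≠ k → s.boxes j = t.boxes j)
    (hk : s.boxes k = t.boxes k) : s = t :=
  ext_boxes fun j hj => if e : j = k then e ▸ hk else h j hj e

theorem boxes_pred (t : Tableau n lam) (hk : 1 ≤ k) (hkn : k ≤ n) :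
    t.boxes k = t.boxes (k - 1) + 1 ∨ t.boxes (k - 1) = t.boxes k + 1 := by
  have := t.boxes_step (k := k - 1) (by omega)
  rwa [Nat.sub_add_cancel hk] at this

theorem eq_peak (hk : 1 ≤ k) (hkn : k < n) (ht : t.Turns k) {s : Tableau n lam}
    (h : ∀ j ≤ n, j ≠ k → s.boxes j = t.boxes j) (hs : s.boxes k = t.boxes (k - 1) + 1) :
    s = t.peak k :=
  eq_of_boxes_of_ne k (fun j hj hjk => by rw [h j hj hjk, boxes_peak_of_ne hk hkn ht hj hjk])
    (by rw [hs, boxes_peak_self hk hkn ht])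

theorem eq_valley (hk : 1 ≤ k) (hkn : k < n) (ht : t.Turns k) {s : Tableau n lam}
    (h : ∀ j ≤ n, j ≠ k → s.boxes j = t.boxes j) (hs : t.boxes (k - 1) = s.boxes k + 1) :
    s = t.valley k :=
  eq_of_boxes_of_ne k
    (fun j hj hjk => by rw [h j hj hjk, boxes_valley_of_ne hk hkn ht (by omega) hj hjk])
    (by rw [boxes_valley_self hk hkn ht (by omega)]; omega)

end Tableau

/-! ### The seminormal representation -/

section Seminormal

variable {K : Type} [Field K] (x : K) {n : ℕ} {lam : ℕ × ℕ}

/-- The weight of `t` at level `k`; `f_t e_k` is this multiple of a vector depending only on the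
other levels of `t`. -/
def weight (t : Tableau n lam) (k : ℕ) : K :=
  if t.boxes k = t.boxes (k - 1) + 1 then
    p x (t.boxes (k - 1) + 2) / p x (t.boxes (k - 1) + 1) else 1

/-- The combination of the values of `ψ` at the two tableaux agreeing with `t` off level `k`. -/
def average (k : ℕ) (ψ : Tableau n lam → K) (t : Tableau n lam) : K :=
  ψ (t.peak k) + p x (t.boxes (k - 1)) / p x (t.boxes (k - 1) + 1) * ψ (t.valley k)

/-- The action of `e_k` on functions of tableaux, dual to its right action on the seminormal
basis. -/
def seminormalOp (n : ℕ) (lam : ℕ × ℕ) (k : ℕ) : Module.End K (Tableau n lam → K) where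
  toFun ψ t := if t.Turns k then weight x t k * average x k ψ t else 0
  map_add' φ ψ := by
    funext t
    simp only [Pi.add_apply, average]
    split_ifs <;> ring
  map_smul' c ψ := by
    funext t
    simp only [Pi.smul_apply, average, smul_eq_mul, RingHom.id_apply]
    split_ifs <;> ring

variable {x} {t : Tableau n lam} {k : ℕ}

theorem seminormalOp_of_turns (ht : t.Turns k) (ψ : Tableau n lam → K) :
    seminormalOp x n lam k ψ t = weight x t k * average x k ψ t := if_pos ht

theorem seminormalOp_of_not_turns (ht : ¬ t.Turns k) (ψ : Tableau n lam → K) :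
    seminormalOp x n lam k ψ t = 0 := if_neg ht

/-- `s` and `t` agree at all levels other than `k`. -/
def AgreeOff (k : ℕ) (s t : Tableau n lam) : Prop := ∀ j ≤ n, j ≠ k → s.boxes j = t.boxes j

theorem AgreeOff.turns {s : Tableau n lam} (h : AgreeOff k s t) (hk : 1 ≤ k) (hkn : k < n)
    (ht : t.Turns k) : s.Turns k := by
  unfold Tableau.Turns at *
  rw [h _ (by omega) (by omega), h _ (by omega) (by omega), ht]

theorem AgreeOff.peak_eq {s : Tableau n lam} (h : AgreeOff k s t) (hk : 1 ≤ k) (hkn : k < n)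
    (ht : t.Turns k) : s.peak k = t.peak k := by
  have hs := h.turns hk hkn ht
  refine Tableau.eq_peak hk hkn ht (fun j hj hjk => ?_) ?_
  · rw [Tableau.boxes_peak_of_ne hk hkn hs hj hjk, h j hj hjk]
  · rw [Tableau.boxes_peak_self hk hkn hs, h _ (by omega) (by omega)]

theorem AgreeOff.valley_eq {s : Tableau n lam} (h : AgreeOff k s t) (hk : 1 ≤ k) (hkn : k < n)
    (ht : t.Turns k) (h0 : t.boxes (k - 1) ≠ 0) : s.valley k = t.valley k := by
  have hs := h.turns hk hkn ht
  have e := h (k - 1) (by omega) (by omega)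
  refine Tableau.eq_valley hk hkn ht (fun j hj hjk => ?_) ?_
  · rw [Tableau.boxes_valley_of_ne hk hkn hs (by omega) hj hjk, h j hj hjk]
  · rw [Tableau.boxes_valley_self hk hkn hs (by omega)]; omega

theorem AgreeOff.average_eq {s : Tableau n lam} (h : AgreeOff k s t) (hk : 1 ≤ k) (hkn : k < n)
    (ht : t.Turns k) (ψ : Tableau n lam → K) : average x k ψ s = average x k ψ t := by
  have e := h (k - 1) (by omega) (by omega)
  rw [average, average, h.peak_eq hk hkn ht, e]
  -- Over height 0 there is no valley and `valley` takes its default value; the coefficient p_0 = 0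
  -- makes this harmless, here and in every later split of this kind.
  by_cases h0 : t.boxes (k - 1) = 0
  · rw [h0, p_zero]; simp
  · rw [h.valley_eq hk hkn ht h0]

theorem agreeOff_peak (hk : 1 ≤ k) (hkn : k < n) (ht : t.Turns k) : AgreeOff k (t.peak k) t :=
  fun _ hj hjk => Tableau.boxes_peak_of_ne hk hkn ht hj hjk

theorem agreeOff_valley (hk : 1 ≤ k) (hkn : k < n) (ht : t.Turns k) (h0 : t.boxes (k - 1) ≠ 0) :
    AgreeOff k (t.valley k) t :=
  fun _ hj hjk => Tableau.boxes_valley_of_ne hk hkn ht h0 hj hjk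

theorem weight_peak (hk : 1 ≤ k) (hkn : k < n) (ht : t.Turns k) :
    weight x (t.peak k) k = p x (t.boxes (k - 1) + 2) / p x (t.boxes (k - 1) + 1) := by
  have e := agreeOff_peak hk hkn ht (k - 1) (by omega) (by omega)
  rw [weight, e, if_pos (Tableau.boxes_peak_self hk hkn ht)]

theorem weight_valley (hk : 1 ≤ k) (hkn : k < n) (ht : t.Turns k) (h0 : t.boxes (k - 1) ≠ 0) :
    weight x (t.valley k) k = 1 := by
  have e := agreeOff_valley hk hkn ht h0 (k - 1) (by omega) (by omega)
  rw [weight, e, if_neg]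
  rw [Tableau.boxes_valley_self hk hkn ht h0]
  omega

theorem seminormalOp_peak (hk : 1 ≤ k) (hkn : k < n) (ht : t.Turns k) (ψ : Tableau n lam → K) :
    seminormalOp x n lam k ψ (t.peak k)
      = p x (t.boxes (k - 1) + 2) / p x (t.boxes (k - 1) + 1) * average x k ψ t := by
  have a := agreeOff_peak hk hkn ht
  rw [seminormalOp_of_turns (a.turns hk hkn ht), a.average_eq hk hkn ht, weight_peak hk hkn ht]

theorem seminormalOp_valley (hk : 1 ≤ k) (hkn : k < n) (ht : t.Turns k)
    (h0 : t.boxes (k - 1) ≠ 0) (ψ : Tableau n lam → K) :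
    seminormalOp x n lam k ψ (t.valley k) = average x k ψ t := by
  have a := agreeOff_valley hk hkn ht h0
  rw [seminormalOp_of_turns (a.turns hk hkn ht), a.average_eq hk hkn ht,
    weight_valley hk hkn ht h0, one_mul]

/-- On a peak and valley over height h the operator has rank one and trace (p_{h+2} + p_h) / p_{h+1}
= x. Over height 0 only the peak exists, with entry p_2 / p_1 = x. -/
theorem seminormalOp_sq (hp : ∀ j, p x (j + 1) ≠ 0) (hk : 1 ≤ k) (hkn : k < n) :
    seminormalOp x n lam k * seminormalOp x n lam k = x • seminormalOp x n lam k := by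
  refine LinearMap.ext fun ψ => funext fun t => ?_
  simp only [Module.End.mul_apply, LinearMap.smul_apply, Pi.smul_apply, smul_eq_mul]
  by_cases ht : t.Turns k
  · rw [seminormalOp_of_turns ht, seminormalOp_of_turns ht, average,
      seminormalOp_peak hk hkn ht]
    have h1 := hp (t.boxes (k - 1))
    by_cases h0 : t.boxes (k - 1) = 0
    · rw [h0, p_zero, zero_add, zero_add, p_two, p_one]
      simp only [div_one]
      ring
    · rw [seminormalOp_valley hk hkn ht h0, p_add_two]
      field_simp
      ring
  · rw [seminormalOp_of_not_turns ht, seminormalOp_of_not_turns ht, mul_zero]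

/-- The level next to `k` on the other side of the adjacent level `l`. -/
def outer (k l : ℕ) : ℕ := if l = k + 1 then k + 2 else k - 2

/-- The tableau agreeing with `t` off level `k`, and turning also at the adjacent level `l`. -/
def turned (t : Tableau n lam) (k l : ℕ) : Tableau n lam :=
  if t.boxes (outer k l) = t.boxes (k - 1) + 1 then t.peak k else t.valley k

theorem AgreeOff.turns_of_mem {s : Tableau n lam} {l : ℕ} (h : AgreeOff k s t)
    (h1 : l - 1 ≠ k) (h2 : l + 1 ≠ k) (hl : l < n) : s.Turns l ↔ t.Turns l := by
  unfold Tableau.Turns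
  rw [h _ (by omega) h1, h _ (by omega) h2]

theorem boxes_outer {l : ℕ} (hk : 1 ≤ k) (hkn : k < n) (hl : 1 ≤ l) (hln : l < n)
    (hkl : k + 1 = l ∨ l + 1 = k) (ht : t.Turns k) :
    t.boxes (outer k l) = t.boxes (k - 1) + 1 ∨ t.boxes (k - 1) = t.boxes (outer k l) + 1 := by
  unfold Tableau.Turns at ht
  unfold outer
  rcases hkl with rfl | rfl
  · rw [if_pos rfl, ht]
    exact t.boxes_step hln
  · rw [if_neg (by omega), Nat.add_sub_cancel, show l + 1 - 2 = l - 1 by omega]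
    have := t.boxes_pred hl hln.le
    omega

/-- A function supported on tableaux turning at `k` is mapped by `e_k e_l`, for `l` adjacent to
`k`, to a function determined by one of its values. -/
theorem seminormalOp_adjacent_apply (hp : ∀ j, p x (j + 1) ≠ 0) {l : ℕ} (hk : 1 ≤ k)
    (hkn : k < n) (hl : 1 ≤ l) (hln : l < n) (hkl : k + 1 = l ∨ l + 1 = k)
    {θ : Tableau n lam → K} (hθ : ∀ u : Tableau n lam, ¬ u.Turns k → θ u = 0) (ht : t.Turns k) :
    seminormalOp x n lam k (seminormalOp x n lam l θ) t
      = weight x t k * (θ (turned t k l) / weight x (turned t k l) k) := by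
  rw [seminormalOp_of_turns ht]
  congr 1
  have hout := boxes_outer hk hkn hl hln hkl ht
  have hon : outer k l ≤ n := by unfold outer; split_ifs <;> omega
  have hok : outer k l ≠ k := by unfold outer; split_ifs <;> omega
  -- in terms of `outer`, turning at `l` only involves the levels `k` and `outer k l`
  have turns_l : ∀ u : Tableau n lam, u.Turns l ↔ u.boxes k = u.boxes (outer k l) := by
    intro u
    unfold Tableau.Turns outer
    rcases hkl with rfl | rfl
    · simp
    · rw [if_neg (by omega), show l + 1 - 2 = l - 1 by omega, eq_comm]
  have lpred : ∀ u : Tableau n lam, u.Turns l → u.boxes (l - 1) = u.boxes k := by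
    intro u hu
    rcases hkl with rfl | rfl
    · simp
    · exact hu
  have hlk : l ≠ k := by omega
  have levels : ∀ u : Tableau n lam, u.Turns k → u.boxes l = u.boxes (k - 1) := by
    intro u hu
    rcases hkl with rfl | rfl
    · exact hu.symm
    · simp
  -- replacing the level `l` by something else destroys the turn at `k`
  have notturn : ∀ u v : Tableau n lam, u.Turns k → AgreeOff l v u → v.boxes l ≠ u.boxes l →
      ¬ v.Turns k := by
    intro u v hu hv hne hvk
    unfold Tableau.Turns at *
    rcases hkl with rfl | rfl
    · have := hv (k - 1) (by omega) (by omega)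
      omega
    · have := hv (l + 1 + 1) (by omega) (by omega)
      simp only [Nat.add_sub_cancel] at *
      omega
  have ap := agreeOff_peak hk hkn ht
  have hpk := Tableau.boxes_peak_self hk hkn ht
  have htp := ap.turns hk hkn ht
  have hpo := ap _ hon hok
  have hpp := ap (k - 1) (by omega) (by omega)
  have hp1 := hp (t.boxes (k - 1))
  have hp2 := hp (t.boxes (k - 1) + 1)
  rw [average]
  rcases hout with hout | hout
  · rw [turned, if_pos hout, weight_peak hk hkn ht]
    -- the valley does not contribute
    have hv : p x (t.boxes (k - 1)) / p x (t.boxes (k - 1) + 1)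
        * seminormalOp x n lam l θ (t.valley k) = 0 := by
      by_cases h0 : t.boxes (k - 1) = 0
      · rw [h0, p_zero]; simp
      · rw [seminormalOp_of_not_turns, mul_zero]
        rw [turns_l, Tableau.boxes_valley_self hk hkn ht h0,
          Tableau.boxes_valley_of_ne hk hkn ht h0 hon hok]
        omega
    -- The peak at k is itself a valley at l, over height h + 1; its coefficient p_{h+1} / p_{h+2}
    -- there is the inverse of its weight at k. Its partner at l no longer turns at k, so θ vanishes
    -- on it.
    have hpl : (t.peak k).Turns l := by rw [turns_l]; omega
    have hlp := lpred _ hpl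
    have hll := levels _ htp
    have e1 : (t.peak k).valley l = t.peak k :=
      (Tableau.eq_valley hl hln hpl (fun _ _ _ => rfl) (by omega)).symm
    have e2 : θ ((t.peak k).peak l) = 0 := by
      refine hθ _ (notturn _ _ htp (agreeOff_peak hl hln hpl) ?_)
      rw [Tableau.boxes_peak_self hl hln hpl]
      omega
    rw [hv, add_zero, seminormalOp_of_turns hpl, average, e1, e2, weight, if_neg (by omega), hlp,
      hpk]
    field_simp
    ring
  -- Now the valley at k is a peak at l, over height h - 1; its weight p_{h+1} / p_h there cancels
  -- the coefficient p_h / p_{h+1} of the valley.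
  · have h0 : t.boxes (k - 1) ≠ 0 := by omega
    have av := agreeOff_valley hk hkn ht h0
    have hvk := Tableau.boxes_valley_self hk hkn ht h0
    have htv := av.turns hk hkn ht
    have hvo := av _ hon hok
    have hvv := av (k - 1) (by omega) (by omega)
    rw [turned, if_neg (by omega), weight_valley hk hkn ht h0]
    have hv : seminormalOp x n lam l θ (t.peak k) = 0 := by
      rw [seminormalOp_of_not_turns]
      rw [turns_l]
      omega
    have hvl : (t.valley k).Turns l := by rw [turns_l]; omega
    have hlp := lpred _ hvl
    have hll := levels _ htv
    have e1 : (t.valley k).peak l = t.valley k :=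
      (Tableau.eq_peak hl hln hvl (fun _ _ _ => rfl) (by omega)).symm
    have e2 : p x ((t.valley k).boxes (l - 1)) * θ ((t.valley k).valley l) = 0 := by
      by_cases h1 : (t.valley k).boxes (l - 1) = 0
      · rw [h1, p_zero, zero_mul]
      · rw [hθ _ (notturn _ _ htv (agreeOff_valley hl hln hvl h1) ?_), mul_zero]
        rw [Tableau.boxes_valley_self hl hln hvl h1]
        omega
    rw [hv, zero_add, seminormalOp_of_turns hvl, average, e1, div_mul_eq_mul_div _ _ (θ _), e2,
      weight, if_pos (by omega), hlp, hvk]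
    have e3 : t.boxes (k - 1) - 1 + 1 = t.boxes (k - 1) := by omega
    have e4 : t.boxes (k - 1) - 1 + 2 = t.boxes (k - 1) + 1 := by omega
    have hp3 := hp (t.boxes (k - 1) - 1)
    rw [e3] at hp3
    rw [e3, e4]
    field_simp
    ring

theorem agreeOff_turned {l : ℕ} (hk : 1 ≤ k) (hkn : k < n) (hl : 1 ≤ l) (hln : l < n)
    (hkl : k + 1 = l ∨ l + 1 = k) (ht : t.Turns k) : AgreeOff k (turned t k l) t := by
  have hout := boxes_outer hk hkn hl hln hkl ht
  unfold turned
  split_ifs with h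
  · exact agreeOff_peak hk hkn ht
  · exact agreeOff_valley hk hkn ht (by omega)

theorem weight_ne_zero (hp : ∀ j, p x (j + 1) ≠ 0) : weight x t k ≠ 0 := by
  unfold weight
  split_ifs
  · exact div_ne_zero (hp _) (hp _)
  · exact one_ne_zero

/-- A function in the image of e_k is, on each peak-valley pair, a multiple of the weight, so its
value at the single member turning also at l determines it there; e_k e_l recovers it from that
value. -/
theorem seminormalOp_adjacent (hp : ∀ j, p x (j + 1) ≠ 0) {l : ℕ} (hk : 1 ≤ k)
    (hkn : k < n) (hl : 1 ≤ l) (hln : l < n) (hkl : k + 1 = l ∨ l + 1 = k) :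
    seminormalOp x n lam k * seminormalOp x n lam l * seminormalOp x n lam k
      = seminormalOp x n lam k := by
  refine LinearMap.ext fun ψ => funext fun t => ?_
  simp only [Module.End.mul_apply]
  by_cases ht : t.Turns k
  · have a := agreeOff_turned hk hkn hl hln hkl ht
    rw [seminormalOp_adjacent_apply hp hk hkn hl hln hkl
      (fun u hu => seminormalOp_of_not_turns hu ψ) ht,
      seminormalOp_of_turns (a.turns hk hkn ht), mul_div_cancel_left₀ _ (weight_ne_zero hp),
      a.average_eq hk hkn ht, seminormalOp_of_turns ht]
  · rw [seminormalOp_of_not_turns ht, seminormalOp_of_not_turns ht]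

end Seminormal

/-! ### Commutation of distant generators -/

section Distant

variable {K : Type} [Field K] {x : K} {n : ℕ} {lam : ℕ × ℕ} {t : Tableau n lam} {j k : ℕ}

theorem AgreeOff.weight_eq {s : Tableau n lam} (h : AgreeOff j s t) (hk : k ≠ j)
    (hk' : k - 1 ≠ j) (hkn : k ≤ n) : weight x s k = weight x t k := by
  rw [weight, weight, h k hkn hk, h (k - 1) (by omega) hk']

theorem Tableau.setBoxes_comm {a b : ℕ} (hj : 1 ≤ j) (hjn : j < n) (hk : 1 ≤ k) (hkn : k < n)
    (hjk : j + 2 ≤ k ∨ k + 2 ≤ j)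
    (h1 : a = t.boxes (j - 1) + 1 ∨ t.boxes (j - 1) = a + 1)
    (h2 : a = t.boxes (j + 1) + 1 ∨ t.boxes (j + 1) = a + 1)
    (h3 : b = t.boxes (k - 1) + 1 ∨ t.boxes (k - 1) = b + 1)
    (h4 : b = t.boxes (k + 1) + 1 ∨ t.boxes (k + 1) = b + 1) :
    (t.setBoxes j a).setBoxes k b = (t.setBoxes k b).setBoxes j a := by
  have hJ := fun {i : ℕ} (hi : i ≤ n) => t.boxes_setBoxes hj hjn h1 h2 hi
  have hK := fun {i : ℕ} (hi : i ≤ n) => t.boxes_setBoxes hk hkn h3 h4 hi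
  refine Tableau.ext_boxes fun i hi => ?_
  rw [Tableau.boxes_setBoxes _ hk hkn, hJ hi, Tableau.boxes_setBoxes _ hj hjn, hK hi]
  · split_ifs <;> first | rfl | omega
  · rw [hK (by omega), if_neg (by omega)]; exact h1
  · rw [hK (by omega), if_neg (by omega)]; exact h2
  · exact hi
  · rw [hJ (by omega), if_neg (by omega)]; exact h3
  · rw [hJ (by omega), if_neg (by omega)]; exact h4
  · exact hi

/-- Changing level j affects neither the turn nor the weight at k, so the product is a sum over the
four corners of a square with product coefficients, symmetric in j and k up to the order of the two
changes. -/
theorem seminormalOp_distant_apply (hj : 1 ≤ j) (hjn : j < n) (hk : 1 ≤ k) (hkn : k < n)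
    (hjk : j + 2 ≤ k ∨ k + 2 ≤ j) (htj : t.Turns j) (htk : t.Turns k) (ψ : Tableau n lam → K) :
    seminormalOp x n lam j (seminormalOp x n lam k ψ) t
      = weight x t j * weight x t k * (ψ ((t.peak j).peak k)
        + p x (t.boxes (k - 1)) / p x (t.boxes (k - 1) + 1) * ψ ((t.peak j).valley k)
        + p x (t.boxes (j - 1)) / p x (t.boxes (j - 1) + 1) * (ψ ((t.valley j).peak k)
        + p x (t.boxes (k - 1)) / p x (t.boxes (k - 1) + 1) * ψ ((t.valley j).valley k))) := by
  have key : ∀ s : Tableau n lam, AgreeOff j s t → seminormalOp x n lam k ψ s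
      = weight x t k * (ψ (s.peak k)
        + p x (t.boxes (k - 1)) / p x (t.boxes (k - 1) + 1) * ψ (s.valley k)) := by
    intro s hs
    rw [seminormalOp_of_turns ((hs.turns_of_mem (by omega) (by omega) hkn).2 htk), average,
      hs.weight_eq (by omega) (by omega) hkn.le, hs (k - 1) (by omega) (by omega)]
  rw [seminormalOp_of_turns htj, average, key _ (agreeOff_peak hj hjn htj)]
  by_cases h0 : t.boxes (j - 1) = 0
  · rw [h0, p_zero]; ring
  · rw [key _ (agreeOff_valley hj hjn htj h0)]; ring

theorem seminormalOp_distant (hj : 1 ≤ j) (hjn : j < n) (hk : 1 ≤ k) (hkn : k < n)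
    (hjk : j + 2 ≤ k ∨ k + 2 ≤ j) :
    seminormalOp x n lam j * seminormalOp x n lam k
      = seminormalOp x n lam k * seminormalOp x n lam j := by
  have vanish : ∀ {j k : ℕ} (hj : 1 ≤ j) (hjn : j < n) (hk : 1 ≤ k) (hkn : k < n)
      (hjk : j + 2 ≤ k ∨ k + 2 ≤ j) (t : Tableau n lam) (ψ : Tableau n lam → K),
      ¬ t.Turns k → seminormalOp x n lam j (seminormalOp x n lam k ψ) t = 0 := by
    intro j k hj hjn hk hkn hjk t ψ htk
    by_cases htj : t.Turns j
    · have key : ∀ s : Tableau n lam, AgreeOff j s t → seminormalOp x n lam k ψ s = 0 :=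
        fun s hs => seminormalOp_of_not_turns
          (fun h => htk ((hs.turns_of_mem (by omega) (by omega) hkn).1 h)) _
      rw [seminormalOp_of_turns htj, average, key _ (agreeOff_peak hj hjn htj)]
      by_cases h0 : t.boxes (j - 1) = 0
      · rw [h0, p_zero]; ring
      · rw [key _ (agreeOff_valley hj hjn htj h0)]; ring
    · exact seminormalOp_of_not_turns htj _
  refine LinearMap.ext fun ψ => funext fun t => ?_
  simp only [Module.End.mul_apply]
  by_cases htj : t.Turns j
  swap
  · rw [vanish hk hkn hj hjn hjk.symm t ψ htj, seminormalOp_of_not_turns htj]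
  by_cases htk : t.Turns k
  swap
  · rw [vanish hj hjn hk hkn hjk t ψ htk, seminormalOp_of_not_turns htk]
  rw [seminormalOp_distant_apply hj hjn hk hkn hjk htj htk,
    seminormalOp_distant_apply hk hkn hj hjn hjk.symm htk htj]
  have hj' := htj
  have hk' := htk
  unfold Tableau.Turns at hj' hk'
  have e1 : (t.peak j).peak k = (t.peak k).peak j := by
    have h1 := agreeOff_peak hj hjn htj (k - 1) (by omega) (by omega)
    have h2 := agreeOff_peak hk hkn htk (j - 1) (by omega) (by omega)
    unfold Tableau.peak at *
    rw [h1, h2]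
    exact Tableau.setBoxes_comm hj hjn hk hkn hjk (by omega) (by omega) (by omega) (by omega)
  have e2 : t.boxes (k - 1) ≠ 0 → (t.peak j).valley k = (t.valley k).peak j := by
    intro h0
    have h1 := agreeOff_peak hj hjn htj (k - 1) (by omega) (by omega)
    have h2 := agreeOff_valley hk hkn htk h0 (j - 1) (by omega) (by omega)
    unfold Tableau.peak Tableau.valley at *
    rw [h1, h2]
    exact Tableau.setBoxes_comm hj hjn hk hkn hjk (by omega) (by omega) (by omega) (by omega)
  have e3 : t.boxes (j - 1) ≠ 0 → (t.valley j).peak k = (t.peak k).valley j := by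
    intro h0
    have h1 := agreeOff_valley hj hjn htj h0 (k - 1) (by omega) (by omega)
    have h2 := agreeOff_peak hk hkn htk (j - 1) (by omega) (by omega)
    unfold Tableau.peak Tableau.valley at *
    rw [h1, h2]
    exact Tableau.setBoxes_comm hj hjn hk hkn hjk (by omega) (by omega) (by omega) (by omega)
  have e4 : t.boxes (j - 1) ≠ 0 → t.boxes (k - 1) ≠ 0 →
      (t.valley j).valley k = (t.valley k).valley j := by
    intro h0 h0'
    have h1 := agreeOff_valley hj hjn htj h0 (k - 1) (by omega) (by omega)
    have h2 := agreeOff_valley hk hkn htk h0' (j - 1) (by omega) (by omega)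
    unfold Tableau.valley at *
    rw [h1, h2]
    exact Tableau.setBoxes_comm hj hjn hk hkn hjk (by omega) (by omega) (by omega) (by omega)
  rw [e1]
  by_cases h0 : t.boxes (j - 1) = 0 <;> by_cases h0' : t.boxes (k - 1) = 0
  · rw [h0, h0', p_zero]; ring
  · rw [h0, p_zero, e2 h0']; ring
  · rw [h0', p_zero, e3 h0]; ring
  · rw [e2 h0', e3 h0, e4 h0 h0']; ring

end Distant

/-! ### The representation defined by the seminormal operators -/

section Rep

variable {K : Type} [Field K] {x : K} (hp : ∀ j, p x (j + 1) ≠ 0) {n : ℕ} (lam : ℕ × ℕ)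

/-- The dual of the seminormal representation of the Temperley–Lieb algebra. -/
def seminormalRep : TL K x n →ₐ[K] Module.End K (Tableau n lam → K) :=
  RingQuot.liftAlgHom K ⟨FreeAlgebra.lift K fun i : GenIdx n => seminormalOp x n lam i.1, by
    intro a b h
    induction h with
    | sq i =>
      simp only [map_mul, map_smul, FreeAlgebra.lift_ι_apply]
      exact seminormalOp_sq hp i.2.1 i.2.2
    | adjacent i j h =>
      simp only [map_mul, FreeAlgebra.lift_ι_apply]
      exact seminormalOp_adjacent hp i.2.1 i.2.2 j.2.1 j.2.2 h
    | distant i j h =>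
      simp only [map_mul, FreeAlgebra.lift_ι_apply]
      exact seminormalOp_distant i.2.1 i.2.2 j.2.1 j.2.2 h⟩

theorem seminormalRep_e {k : ℕ} (hk : 1 ≤ k) (hkn : k < n) :
    seminormalRep hp lam (e x n k) = seminormalOp x n lam k := by
  rw [e, dif_pos ⟨hk, hkn⟩, seminormalRep, RingQuot.liftAlgHom_mkAlgHom_apply,
    FreeAlgebra.lift_ι_apply]

end Rep

/-! ### The eigenvalues of the Jucys–Murphy elements -/

section Contents

variable {S : Type} [CommRing S] (x : S) {n : ℕ} {lam : ℕ × ℕ} (t : Tableau n lam) {k : ℕ}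

theorem r_of_up (hk : 1 ≤ k) (hkn : k ≤ n) (h : t.boxes k = t.boxes (k - 1) + 1) :
    r x t k = - (p x (t.shape (k - 1)).1 * p x ((t.shape (k - 1)).1 + t.boxes (k - 1))) := by
  have h1 := t.shape_weight hkn
  have h2 := t.shape_weight (k := k - 1) (by omega)
  have e : (t.shape k).1 = (t.shape (k - 1)).1 := by omega
  unfold r
  split_ifs with hk2
  · have : (t.shape (k - 1)).1 = 0 := by omega
    rw [this, p_zero]; ring
  · simp only
    rw [if_neg (by omega), e]
    generalize (t.shape (k - 1)).1 = a at *
    rw [show k - a + 1 = a + t.boxes (k - 1) + 2 by omega,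
      show k - a = a + t.boxes (k - 1) + 1 by omega, p_add_two]
    ring

theorem r_of_down (hk : 1 ≤ k) (hkn : k ≤ n) (h : t.boxes (k - 1) = t.boxes k + 1) :
    r x t k = (p x ((t.shape (k - 1)).1 + 1) - x * p x (t.shape (k - 1)).1)
      * p x ((t.shape (k - 1)).1 + t.boxes (k - 1) + 1) := by
  have h1 := t.shape_weight hkn
  have h2 := t.shape_weight (k := k - 1) (by omega)
  have e : (t.shape k).1 = (t.shape (k - 1)).1 + 1 := by omega
  unfold r
  simp only
  rw [if_neg (by omega), if_pos e.symm, e, Nat.add_sub_cancel]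
  generalize (t.shape (k - 1)).1 = a at *
  rw [show k - (a + 1) + 1 = a + t.boxes (k - 1) + 1 by omega]

theorem z_succ : z x t (k + 1) = r x t (k + 1) + x * z x t k := by
  unfold z
  rw [Finset.sum_range_succ', add_comm, Finset.mul_sum]
  congr 1
  · simp
  · refine Finset.sum_congr rfl fun i _ => ?_
    rw [show k + 1 - (i + 1) = k - i by omega]
    ring

/-- The recursion z(k+1) = r(k+1) + x z(k) collapses: the result depends on the shape at level k
only, not on the path leading to it. -/
theorem z_eq (hkn : k ≤ n) :
    z x t k = p x (t.shape k).1 * p x ((t.shape k).1 + t.boxes k + 1) := by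
  induction k with
  | zero =>
    have := t.shape_weight (Nat.zero_le n)
    have h0 : (t.shape 0).1 = 0 := by omega
    rw [h0, p_zero]
    simp [z, r]
  | succ k ih =>
    have h1 := t.shape_weight hkn
    have h2 := t.shape_weight (k := k) (by omega)
    rw [z_succ, ih (by omega)]
    rcases t.boxes_step (k := k) (by omega) with h | h
    · rw [r_of_up x t (by omega) hkn (by simpa using h), Nat.add_sub_cancel]
      have e : (t.shape (k + 1)).1 = (t.shape k).1 := by omega
      rw [e, h, ← add_assoc, p_add_two]
      ring
    · rw [r_of_down x t (by omega) hkn (by simpa using h), Nat.add_sub_cancel]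
      have e : (t.shape (k + 1)).1 = (t.shape k).1 + 1 := by omega
      rw [e, show (t.shape k).1 + 1 + t.boxes (k + 1) + 1 = (t.shape k).1 + t.boxes k + 1 by omega]
      ring

/-- This is what the recursion for T_{k+1} demands at a path killed by e_k, where only the term
-z_{k-1} survives. -/
theorem r_succ_of_not_turns (hk : 1 ≤ k) (hkn : k < n) (ht : ¬ t.Turns k) :
    r x t (k + 1) = - z x t (k - 1) := by
  have h1 := t.shape_weight (k := k + 1) hkn
  have h2 := t.shape_weight (k := k) (by omega)
  have h3 := t.shape_weight (k := k - 1) (by omega)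
  have s1 := t.boxes_pred hk hkn.le
  have s2 := t.boxes_step hkn
  unfold Tableau.Turns at ht
  rw [z_eq x t (by omega)]
  rcases s1 with s1 | s1
  · rw [r_of_up x t (k := k + 1) (by omega) hkn
      (by rw [Nat.add_sub_cancel]; omega), Nat.add_sub_cancel]
    have e : (t.shape k).1 = (t.shape (k - 1)).1 := by omega
    rw [e, s1, add_assoc]
  · rw [r_of_down x t (k := k + 1) (by omega) hkn
      (by rw [Nat.add_sub_cancel]; omega), Nat.add_sub_cancel]
    have e : (t.shape k).1 = (t.shape (k - 1)).1 + 1 := by omega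
    rw [e, show (t.shape (k - 1)).1 + 1 + t.boxes k + 1 = (t.shape (k - 1)).1
      + t.boxes (k - 1) + 1 by omega, p_add_two]
    ring

theorem r_succ_add_z_of_peak (hk : 1 ≤ k) (hkn : k < n) (ht : t.Turns k)
    (h : t.boxes k = t.boxes (k - 1) + 1) :
    r x t (k + 1) + z x t (k - 1) = p x (t.boxes (k - 1) + 2) := by
  have h2 := t.shape_weight (k := k) (by omega)
  have h3 := t.shape_weight (k := k - 1) (by omega)
  unfold Tableau.Turns at ht
  have e : (t.shape k).1 = (t.shape (k - 1)).1 := by omega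
  rw [z_eq x t (by omega), r_of_down x t (k := k + 1) (by omega) hkn
      (by rw [Nat.add_sub_cancel]; omega),
    Nat.add_sub_cancel, e, h, ← p_mul_sub_mul x (t.shape (k - 1)).1 (t.boxes (k - 1) + 2)]
  simp only [← add_assoc]
  rw [p_add_two x ((t.shape (k - 1)).1 + t.boxes (k - 1) + 1)]
  ring_nf

theorem r_succ_add_z_of_valley (hk : 1 ≤ k) (hkn : k < n) (ht : t.Turns k)
    (h : t.boxes (k - 1) = t.boxes k + 1) :
    r x t (k + 1) + z x t (k - 1) = - p x (t.boxes (k - 1)) := by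
  have h2 := t.shape_weight (k := k) (by omega)
  have h3 := t.shape_weight (k := k - 1) (by omega)
  unfold Tableau.Turns at ht
  have e : (t.shape k).1 = (t.shape (k - 1)).1 + 1 := by omega
  rw [z_eq x t (by omega), r_of_up x t (k := k + 1) (by omega) hkn
      (by rw [Nat.add_sub_cancel]; omega),
    Nat.add_sub_cancel, e,
    ← p_mul_sub_mul x (t.shape (k - 1)).1 (t.boxes (k - 1)),
    show (t.shape (k - 1)).1 + 1 + t.boxes k = (t.shape (k - 1)).1 + t.boxes (k - 1) by omega]
  ring

/-- The two possible values of `r_t(k)`, given the shape at level `k - 1`, differ by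
`p_{h + 1}`. -/
theorem r_down_sub_r_up (a h : ℕ) :
    (p x (a + 1) - x * p x a) * p x (a + h + 1) - -(p x a * p x (a + h)) = p x (h + 1) := by
  rw [← p_mul_sub_mul x a (h + 1)]
  simp only [← add_assoc]
  rw [p_add_two x (a + h)]
  ring

/-- With k = 2a + h + 1 the right side is p_k - x z_t(k - 1), so the denominators in item 4 are the
sum of the two possible eigenvalues minus twice the actual one. -/
theorem r_down_add_r_up (a h : ℕ) :
    (p x (a + 1) - x * p x a) * p x (a + h + 1) + -(p x a * p x (a + h))
      = p x (2 * a + h + 1) - x * (p x a * p x (a + h + 1)) := by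
  rw [show 2 * a + h + 1 = a + (a + h) + 1 by ring, ← p_mul_add_mul x a (a + h)]
  ring

end Contents

/-! ### Diagonal action of the Jucys–Murphy elements -/

section JucysMurphy

variable {K : Type} [Field K] {x : K} {n : ℕ} {lam : ℕ × ℕ} {t : Tableau n lam} {k : ℕ}

theorem AgreeOff.shape_eq {s : Tableau n lam} (h : AgreeOff k s t) {j : ℕ} (hj : j ≤ n)
    (hjk : j ≠ k) : s.shape j = t.shape j := Tableau.shape_eq_of_boxes hj (h j hj hjk)

theorem r_peak (hk : 1 ≤ k) (hkn : k < n) (ht : t.Turns k) :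
    r x (t.peak k) k
      = - (p x (t.shape (k - 1)).1 * p x ((t.shape (k - 1)).1 + t.boxes (k - 1))) := by
  have a := agreeOff_peak hk hkn ht
  have h1 := a (k - 1) (by omega) (by omega)
  rw [r_of_up x _ hk hkn.le (by rw [Tableau.boxes_peak_self hk hkn ht, h1]),
    a.shape_eq (by omega) (by omega), h1]

theorem r_valley (hk : 1 ≤ k) (hkn : k < n) (ht : t.Turns k) (h0 : t.boxes (k - 1) ≠ 0) :
    r x (t.valley k) k = (p x ((t.shape (k - 1)).1 + 1) - x * p x (t.shape (k - 1)).1)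
      * p x ((t.shape (k - 1)).1 + t.boxes (k - 1) + 1) := by
  have a := agreeOff_valley hk hkn ht h0
  have h1 := a (k - 1) (by omega) (by omega)
  rw [r_of_down x _ hk hkn.le
      (by rw [Tableau.boxes_valley_self hk hkn ht h0, h1]; omega),
    a.shape_eq (by omega) (by omega), h1]

theorem z_eq_of_agreeOff {s : Tableau n lam} (h : AgreeOff k s t) {j : ℕ} (hj : j < k)
    (hjn : j ≤ n := by omega) : z x s j = z x t j := by
  rw [z_eq x s hjn, z_eq x t hjn, h.shape_eq hjn (by omega), h j hjn (by omega)]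

/-- The eigenvalue at level `k` of the neighbour of `t` which turns at `k - 1`. -/
theorem r_turned (hk : 2 ≤ k) (hkn : k < n) (ht : t.Turns k) :
    r x (turned t k (k - 1)) k - z x t (k - 2)
      = (p x ((t.shape (k - 1)).1 + 1) - x * p x (t.shape (k - 1)).1)
        * p x ((t.shape (k - 1)).1 + t.boxes (k - 1) + 1)
        + -(p x (t.shape (k - 1)).1 * p x ((t.shape (k - 1)).1 + t.boxes (k - 1))) := by
  have ho := boxes_outer (t := t) (k := k) (l := k - 1) (by omega) hkn (by omega) (by omega)
    (by omega) ht
  have e0 : outer k (k - 1) = k - 2 := if_neg (by omega)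
  rw [e0] at ho
  have w1 := t.shape_weight (k := k - 1) (by omega)
  have w2 := t.shape_weight (k := k - 2) (by omega)
  rw [turned, e0, z_eq x t (by omega)]
  rcases ho with ho | ho
  · rw [if_pos ho, r_peak (by omega) hkn ht, ho]
    have e : (t.shape (k - 1)).1 = (t.shape (k - 2)).1 + 1 := by omega
    rw [e, p_add_two,
      show (t.shape (k - 2)).1 + (t.boxes (k - 1) + 1) + 1
        = (t.shape (k - 2)).1 + 1 + t.boxes (k - 1) + 1 by omega]
    ring
  · rw [if_neg (by omega), r_valley (by omega) hkn ht (by omega)]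
    have e : (t.shape (k - 1)).1 = (t.shape (k - 2)).1 := by omega
    rw [e, ho, add_assoc _ _ 1]
    ring_nf

/-- The left side is the recursion for T_{k+1} at a turn, after e_k e_{k-1} T_k e_k - e_k z_{k-2}
has become (r_up + r_down) e_k; subtracting e_k T_k swaps the two eigenvalues inside the average.
The term T_k e_k then cancels the off-diagonal part, and the diagonal part is r_t(k+1) + z_t(k-1).
-/
theorem r_succ_eq (hp : ∀ j, p x (j + 1) ≠ 0) (hk : 1 ≤ k) (hkn : k < n) (ht : t.Turns k)
    (φ : Tableau n lam → K) :
    weight x t k * ((p x ((t.shape (k - 1)).1 + 1) - x * p x (t.shape (k - 1)).1)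
        * p x ((t.shape (k - 1)).1 + t.boxes (k - 1) + 1) * φ (t.peak k)
      + p x (t.boxes (k - 1)) / p x (t.boxes (k - 1) + 1)
        * (-(p x (t.shape (k - 1)).1 * p x ((t.shape (k - 1)).1 + t.boxes (k - 1)))
          * φ (t.valley k)) - r x t k * average x k φ t) - z x t (k - 1) * φ t
      = r x t (k + 1) * φ t := by
  have hd := r_down_sub_r_up x (t.shape (k - 1)).1 (t.boxes (k - 1))
  have h1 := hp (t.boxes (k - 1))
  rcases t.boxes_pred hk hkn.le with h | h
  · have e : t = t.peak k := Tableau.eq_peak hk hkn ht (fun _ _ _ => rfl) h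
    have hr := r_succ_add_z_of_peak x t hk hkn ht h
    rw [average, ← e, weight, if_pos h, r_of_up x t hk hkn.le h, ← sub_eq_iff_eq_add.2 hr.symm,
      ← hd]
    rw [← hd] at h1
    field_simp
    ring
  · have e : t = t.valley k := Tableau.eq_valley hk hkn ht (fun _ _ _ => rfl) h
    have hr := r_succ_add_z_of_valley x t hk hkn ht h
    rw [average, ← e, weight, if_neg (by omega), r_of_down x t hk hkn.le h,
      ← sub_eq_iff_eq_add.2 hr.symm, ← hd]
    rw [← hd] at h1
    field_simp
    ring

theorem jm_add_three {S : Type} [CommRing S] (x : S) (n i : ℕ) : jm x n (i + 3) =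
    - (e x n (i + 2) * jm x n (i + 2)) - jm x n (i + 2) * e x n (i + 2)
      + e x n (i + 2) * e x n (i + 1) * jm x n (i + 2) * e x n (i + 2)
      - ∑ k ∈ Finset.range (i + 2), x ^ k • jm x n (i + 1 - k)
      - e x n (i + 2) * ∑ k ∈ Finset.range (i + 1), x ^ k • jm x n (i - k) := by
  rw [jm, Finset.sum_range, Finset.sum_range]

/-- The Jucys–Murphy elements act diagonally in the seminormal representation. -/
theorem seminormalRep_jm_apply (hp : ∀ j, p x (j + 1) ≠ 0) (hkn : k ≤ n) (φ : Tableau n lam → K)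
    (t : Tableau n lam) : seminormalRep hp lam (jm x n k) φ t = r x t k * φ t := by
  induction k using Nat.strong_induction_on generalizing φ t with
  | _ k ih =>
  match k, hkn, ih with
  | 0, _, _ => simp [jm, r]
  | 1, _, _ => simp [jm, r]
  | 2, hkn, _ =>
    rw [jm, seminormalRep_e hp lam le_rfl hkn]
    have hz : z x t 0 = 0 := by simp [z, r]
    by_cases ht : t.Turns 1
    -- T_2 = e_1 fits the general recursion at k = 1, where the shape at level 0 is empty and r_t(1)
    -- = z_t(0) = 0.
    · rw [← r_succ_eq hp le_rfl hkn ht, seminormalOp_of_turns ht, average]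
      have w := t.shape_weight (Nat.zero_le n)
      have h0 := t.boxes_zero
      have h00 : (t.shape 0).1 = 0 := by omega
      simp [h0, h00, p_zero, p_one, hz, r]
    · have := r_succ_of_not_turns x t le_rfl hkn ht
      simp only [Nat.reduceAdd, Nat.sub_self, hz, neg_zero] at this
      rw [seminormalOp_of_not_turns ht, this, zero_mul]
  | i + 3, hkn, ih =>
    have hz : ∀ j, j < i + 3 → ∀ (φ : Tableau n lam → K) (t : Tableau n lam),
        seminormalRep hp lam (∑ k ∈ Finset.range (j + 1), x ^ k • jm x n (j - k)) φ t
          = z x t j * φ t := by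
      intro j hj φ t
      rw [map_sum, LinearMap.sum_apply, Finset.sum_apply, z, Finset.sum_mul]
      refine Finset.sum_congr rfl fun l _ => ?_
      rw [map_smul, LinearMap.smul_apply, Pi.smul_apply, ih (j - l) (by omega) (by omega),
        smul_eq_mul, mul_assoc]
    have hT := ih (i + 2) (by omega) (by omega)
    have he := seminormalRep_e hp lam (n := n) (k := i + 2) (by omega) (by omega)
    have he' := seminormalRep_e hp lam (n := n) (k := i + 1) (by omega) (by omega)
    rw [jm_add_three]
    simp only [map_sub, map_add, map_neg, map_mul, LinearMap.sub_apply, LinearMap.add_apply,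
      LinearMap.neg_apply, Module.End.mul_apply, Pi.sub_apply, Pi.add_apply, Pi.neg_apply,
      hz (i + 1) (by omega), hT, he, he']
    set T := seminormalRep hp lam (jm x n (i + 2)) with hTdef
    by_cases ht : t.Turns (i + 2)
    · have hk : 1 ≤ i + 2 := by omega
      have hkn' : i + 2 < n := hkn
      have a := agreeOff_turned (l := i + 1) hk hkn' (by omega) (by omega) (by omega) ht
      -- The function fed to e_k e_{k-1} is T_k e_k φ; it is still supported on paths turning at k
      -- because T_k is diagonal by induction.
      rw [seminormalOp_adjacent_apply hp hk hkn' (by omega) (by omega) (by omega) ?_ ht, hT,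
        seminormalOp_of_turns (a.turns hk hkn' ht), a.average_eq hk hkn' ht,
        mul_left_comm (r x _ _), mul_div_cancel_left₀ _ (weight_ne_zero hp)]
      · have hrt := r_turned (x := x) (by omega) hkn' ht
        simp only [Nat.add_one_sub_one, Nat.add_sub_cancel] at hrt
        rw [← r_succ_eq hp hk hkn' ht]
        simp only [seminormalOp_of_turns ht, Nat.add_one_sub_one]
        have e1 : average x (i + 2) (T φ) t = r x (t.peak (i + 2)) (i + 2) * φ (t.peak (i + 2))
            + p x (t.boxes (i + 1)) / p x (t.boxes (i + 1) + 1)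
              * (r x (t.valley (i + 2)) (i + 2) * φ (t.valley (i + 2))) := by
          rw [average, hT, hT]; rfl
        -- The factor p_h makes the formula for the valley eigenvalue valid also over height 0,
        -- where there is no valley.
        have hcoef : p x (t.boxes (i + 1)) * r x (t.valley (i + 2)) (i + 2)
            = p x (t.boxes (i + 1)) * ((p x ((t.shape (i + 1)).1 + 1) - x * p x (t.shape (i + 1)).1)
              * p x ((t.shape (i + 1)).1 + t.boxes (i + 1) + 1)) := by
          by_cases h0 : t.boxes (i + 1) = 0
          · rw [h0, p_zero, zero_mul, zero_mul]
          · rw [r_valley hk hkn' ht h0]; rfl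
        have e2 : average x (i + 2) (seminormalRep hp lam
            (∑ k ∈ Finset.range (i + 1), x ^ k • jm x n (i - k)) φ) t
            = z x t i * average x (i + 2) φ t := by
          rw [average, average, hz i (by omega), hz i (by omega),
            z_eq_of_agreeOff (agreeOff_peak hk hkn' ht) (by omega)]
          by_cases h0 : t.boxes (i + 2 - 1) = 0
          · rw [h0, p_zero]; ring
          · rw [z_eq_of_agreeOff (agreeOff_valley hk hkn' ht h0) (by omega)]; ring
        have hP := r_peak (x := x) hk hkn' ht
        simp only [Nat.add_one_sub_one] at hP
        have e3 : average x (i + 2) φ t = φ (t.peak (i + 2))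
            + p x (t.boxes (i + 1)) / p x (t.boxes (i + 1) + 1) * φ (t.valley (i + 2)) := rfl
        rw [e1, e2, e3]
        generalize turned t (i + 2) (i + 1) = u at *
        rw [hP]
        rw [eq_add_of_sub_eq hrt]
        linear_combination (- weight x t (i + 2) / p x (t.boxes (i + 1) + 1)
          * φ (t.valley (i + 2))) * hcoef
      · intro u hu
        rw [hT, seminormalOp_of_not_turns hu, mul_zero]
    · have := r_succ_of_not_turns x t (by omega) hkn ht
      simp only [seminormalOp_of_not_turns ht]
      rw [this]
      simp

end JucysMurphy

/-! ### The idempotents -/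

section Idempotents

namespace Tableau

variable {n : ℕ} {lam : ℕ × ℕ}

/-- The restriction `𝔱|_k`. -/
def restrict (t : Tableau n lam) {k : ℕ} (hk : k ≤ n) : Tableau k (t.shape k) where
  seq j := t.shape j
  seq_zero := by
    have h := t.shape_eq (Nat.zero_le n)
    exact h.trans t.seq_zero
  seq_step j := by
    have h := t.seq_step ⟨j.1, by omega⟩
    have h1 := t.shape_eq (k := j.1) (by omega)
    have h2 := t.shape_eq (k := j.1 + 1) (by omega)
    simp only [Fin.val_castSucc, Fin.val_succ]
    rw [h1, h2]
    exact h
  seq_last := by simp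

theorem shape_restrict (t : Tableau n lam) {k j : ℕ} (hk : k ≤ n) (hj : j ≤ k) :
    (t.restrict hk).shape j = t.shape j := by
  rw [shape_eq _ hj]
  rfl

theorem shape_mem_partitions (t : Tableau n lam) {k : ℕ} (hk : k ≤ n) :
    t.shape k ∈ partitions k := by
  have h := t.shape_weight hk
  unfold partitions
  rw [Finset.mem_image]
  refine ⟨(t.shape k).1, ?_, Prod.ext rfl ?_⟩
  · rw [Finset.mem_range]; omega
  · change k - 2 * (t.shape k).1 = t.boxes k
    omega

end Tableau

variable {K : Type} [Field K] {x : K} {n : ℕ} {lam : ℕ × ℕ}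

theorem r_mem_contents (t : Tableau n lam) {k : ℕ} (hk : k ≤ n) : r x t k ∈ contents x k := by
  classical
  unfold contents
  rw [Finset.mem_biUnion]
  refine ⟨t.shape k, t.shape_mem_partitions hk, ?_⟩
  rw [Finset.mem_image]
  refine ⟨t.restrict hk, Finset.mem_univ _, ?_⟩
  unfold r
  rw [t.shape_restrict hk le_rfl, t.shape_restrict hk (Nat.sub_le k 1)]

/-- The eigenvalues of the Jucys–Murphy elements separate the tableaux. -/
theorem exists_r_ne (hp : ∀ j, p x (j + 1) ≠ 0) {s t : Tableau n lam} (h : s ≠ t) :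
    ∃ k, 2 ≤ k ∧ k ≤ n ∧ r x s k ≠ r x t k := by
  by_contra! hr
  refine h (Tableau.ext_boxes fun k => ?_)
  induction k with
  | zero => intro _; rw [s.boxes_zero, t.boxes_zero]
  | succ k ih =>
    intro hk
    have e := ih (by omega)
    have es := Tableau.shape_eq_of_boxes (by omega) e
    rcases Nat.eq_zero_or_pos k with rfl | hk0
    · rw [zero_add, s.boxes_one hk, t.boxes_one hk]
    have hrk := hr (k + 1) (by omega) hk
    -- The shapes agree up to level k; if the next steps differed, equal eigenvalues would force
    -- p_{h+1} = 0.
    have hd := r_down_sub_r_up x (t.shape k).1 (t.boxes k)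
    rcases s.boxes_step hk with hs | hs <;> rcases t.boxes_step hk with ht | ht
    · omega
    · rw [r_of_up x s (by omega) hk (by simpa using hs),
        r_of_down x t (by omega) hk (by simpa using ht)] at hrk
      simp only [Nat.add_sub_cancel, es, e] at hrk
      rw [← hrk, sub_self] at hd
      exact absurd hd.symm (hp _)
    · rw [r_of_down x s (by omega) hk (by simpa using hs),
        r_of_up x t (by omega) hk (by simpa using ht)] at hrk
      simp only [Nat.add_sub_cancel, es, e] at hrk
      rw [hrk, sub_self] at hd
      exact absurd hd.symm (hp _)
    · omega

/-- T_k acts as multiplication by the function t ↦ r_t(k), and a polynomial in a function is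
evaluated pointwise. -/
theorem seminormalRep_aeval_jm_apply (hp : ∀ j, p x (j + 1) ≠ 0) {k : ℕ} (hk : k ≤ n) (q : K[X])
    (φ : Tableau n lam → K) (s : Tableau n lam) :
    seminormalRep hp lam (aeval (jm x n k) q) φ s = q.eval (r x s k) * φ s := by
  have h : seminormalRep hp lam (jm x n k)
      = Algebra.lmul K (Tableau n lam → K) fun t => r x t k := by
    refine LinearMap.ext fun ψ => funext fun t => ?_
    rw [seminormalRep_jm_apply hp hk]
    rfl
  rw [← aeval_algHom_apply, h, aeval_algHom_apply]
  change (aeval (fun t : Tableau n lam => r x t k) q) s * φ s = _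
  congr 1
  have := aeval_algHom_apply (Pi.evalAlgHom K (fun _ : Tableau n lam => K) s)
    (fun t : Tableau n lam => r x t k) q
  rw [← coe_aeval_eq_eval]
  exact this.symm

theorem seminormalRep_prod_aeval_jm_apply (hp : ∀ j, p x (j + 1) ≠ 0) (l : List ℕ)
    (hl : ∀ k ∈ l, k ≤ n) (q : ℕ → K[X]) (φ : Tableau n lam → K) (s : Tableau n lam) :
    seminormalRep hp lam (l.map fun k => aeval (jm x n k) (q k)).prod φ s
      = (l.map fun k => (q k).eval (r x s k)).prod * φ s := by
  induction l with
  | nil => simp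
  | cons k l ih =>
    rw [List.map_cons, List.prod_cons, map_mul, Module.End.mul_apply,
      seminormalRep_aeval_jm_apply hp (hl k List.mem_cons_self),
      ih fun j hj => hl j (List.mem_cons_of_mem _ hj), List.map_cons, List.prod_cons, mul_assoc]

open Classical in
-- At t every factor is 1. At s ≠ t some level has r_s(k) ≠ r_t(k), and the factor indexed by r_s(k)
-- vanishes.
theorem seminormalRep_idem_apply (hp : ∀ j, p x (j + 1) ≠ 0) (t : Tableau n lam)
    (φ : Tableau n lam → K) (s : Tableau n lam) :
    seminormalRep hp lam (idem x t) φ s = if s = t then φ s else 0 := by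
  unfold idem
  rw [seminormalRep_prod_aeval_jm_apply hp _ (by intro k hk; rw [List.mem_range'_1] at hk; omega)
    (fun k => ∏ c ∈ (contents x k).erase (r x t k), (C (r x t k - c)⁻¹ * (X - C c) : K[X]))]
  split_ifs with hst
  · subst hst
    rw [List.prod_eq_one, one_mul]
    intro y hy
    rw [List.mem_map] at hy
    obtain ⟨k, -, rfl⟩ := hy
    rw [eval_prod]
    refine Finset.prod_eq_one fun c hc => ?_
    rw [eval_mul, eval_C, eval_sub, eval_X, eval_C]
    exact inv_mul_cancel₀ (sub_ne_zero.2 (Finset.ne_of_mem_erase hc).symm)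
  · obtain ⟨k, hk2, hkn, hne⟩ := exists_r_ne hp hst
    rw [List.prod_eq_zero, zero_mul]
    rw [List.mem_map]
    refine ⟨k, by rw [List.mem_range'_1]; omega, ?_⟩
    rw [eval_prod]
    refine Finset.prod_eq_zero (Finset.mem_erase.2 ⟨hne, r_mem_contents s hkn⟩) ?_
    simp

end Idempotents

/-! ### The leading coefficients of the Murphy basis -/

section Leading

/-- The numbers of boxes of a path which goes down exactly at the levels `2, 4, …, 2i - 2`
and `j`. -/
def stairBoxes (i j m : ℕ) : ℕ :=
  if m < 2 * i then m % 2 else if m < j then m + 2 - 2 * i else m - 2 * i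

variable {n : ℕ} {lam : ℕ × ℕ}

/-- The most dominant tableau of shape `lam`. -/
def topTableau (hlam : 2 * lam.1 + lam.2 = n) : Tableau n lam :=
  Tableau.ofBoxes (stairBoxes lam.1 (2 * lam.1)) (by unfold stairBoxes; split_ifs <;> omega)
    (by intro k hk; unfold stairBoxes; split_ifs <;> omega)
    (by unfold stairBoxes; split_ifs <;> omega) hlam

theorem boxes_topTableau (hlam : 2 * lam.1 + lam.2 = n) {m : ℕ} (hm : m ≤ n) :
    (topTableau hlam).boxes m = stairBoxes lam.1 (2 * lam.1) m :=
  Tableau.boxes_ofBoxes _ _ _ _ _ hm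

/-- The tableau which agrees with `t` from level `k` on and goes down exactly at the levels
`2, 4, …, 2i - 2` and `j` before that. -/
def stair (t : Tableau n lam) {k j : ℕ} (hk : k ≤ n) (hj : 2 * (t.shape k).1 ≤ j) (hjk : j ≤ k)
    (h0 : 1 ≤ (t.shape k).1 ∨ j = 0) : Tableau n lam :=
  Tableau.ofBoxes (fun m => if m < k then stairBoxes (t.shape k).1 j m else t.boxes m)
    (by
      have := t.boxes_zero
      simp only [stairBoxes]
      split_ifs <;> omega)
    (by
      intro m hm
      have w := t.shape_weight hk
      have s := t.boxes_step hm
      simp only [stairBoxes]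
      rcases lt_trichotomy (m + 1) k with h | h | h
      · rw [if_pos h, if_pos (show m < k by omega)]
        split_ifs <;> omega
      · rw [if_neg (show ¬ m + 1 < k by omega), if_pos (show m < k by omega), h]
        split_ifs <;> omega
      · rw [if_neg (show ¬ m + 1 < k by omega), if_neg (show ¬ m < k by omega)]
        exact s)
    (by rw [if_neg (by omega), t.boxes_self]) t.lam_weight

theorem boxes_stair (t : Tableau n lam) {k j : ℕ} (hk : k ≤ n) (hj : 2 * (t.shape k).1 ≤ j)
    (hjk : j ≤ k) (h0 : 1 ≤ (t.shape k).1 ∨ j = 0) {m : ℕ} (hm : m ≤ n) :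
    (stair t hk hj hjk h0).boxes m
      = if m < k then stairBoxes (t.shape k).1 j m else t.boxes m :=
  Tableau.boxes_ofBoxes _ _ _ _ _ hm

variable {K : Type} [Field K] {x : K}

theorem e_eq_zero {j : ℕ} (h : ¬ (1 ≤ j ∧ j < n)) : e x n j = 0 := dif_neg h

/-- `e_j` preserves the support conditions at the levels other than `j`. -/
theorem seminormalRep_e_support (hp : ∀ j, p x (j + 1) ≠ 0) {j k c : ℕ} (hk : k ≤ n) (hjk : j ≠ k)
    {φ : Tableau n lam → K} (hφ : ∀ u : Tableau n lam, u.boxes k ≠ c → φ u = 0)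
    (u : Tableau n lam) (hu : u.boxes k ≠ c) : seminormalRep hp lam (e x n j) φ u = 0 := by
  by_cases hj : 1 ≤ j ∧ j < n
  · rw [seminormalRep_e hp lam hj.1 hj.2]
    by_cases ht : u.Turns j
    · rw [seminormalOp_of_turns ht, average,
        hφ _ (by rwa [agreeOff_peak hj.1 hj.2 ht k hk hjk.symm])]
      by_cases h0 : u.boxes (j - 1) = 0
      · rw [h0, p_zero]; ring
      · rw [hφ _ (by rwa [agreeOff_valley hj.1 hj.2 ht h0 k hk hjk.symm])]; ring
    · exact seminormalOp_of_not_turns ht _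
  · rw [e_eq_zero hj, map_zero]; rfl

theorem seminormalRep_prod_e_support (hp : ∀ j, p x (j + 1) ≠ 0) {k c : ℕ} (hk : k ≤ n)
    (l : List ℕ) (hl : ∀ j ∈ l, j ≠ k)
    {φ : Tableau n lam → K} (hφ : ∀ u : Tableau n lam, u.boxes k ≠ c → φ u = 0)
    (u : Tableau n lam) (hu : u.boxes k ≠ c) :
    seminormalRep hp lam (l.map (e x n)).prod φ u = 0 := by
  induction l generalizing u with
  | nil => simpa using hφ u hu
  | cons j l ih =>
    rw [List.map_cons, List.prod_cons, map_mul, Module.End.mul_apply]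
    exact seminormalRep_e_support hp hk (hl j List.mem_cons_self)
      (ih fun i hi => hl i (List.mem_cons_of_mem _ hi)) u hu

/-- All letters of v_{t|m} have index below m ≤ k, so level k is never changed. -/
theorem seminormalRep_vRestr_support (hp : ∀ j, p x (j + 1) ≠ 0) (t : Tableau n lam) {k c m : ℕ}
    (hk : k ≤ n) (hmk : m ≤ k)
    {φ : Tableau n lam → K} (hφ : ∀ u : Tableau n lam, u.boxes k ≠ c → φ u = 0)
    (u : Tableau n lam) (hu : u.boxes k ≠ c) :
    seminormalRep hp lam (vRestr x t m) φ u = 0 := by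
  induction m generalizing u with
  | zero => simpa [vRestr] using hφ u hu
  | succ m ih =>
    rw [vRestr]
    split_ifs
    · exact ih (by omega) u hu
    · rw [map_mul, Module.End.mul_apply]
      refine seminormalRep_prod_e_support hp hk _ (fun j hj => ?_) (ih (by omega)) u hu
      rw [List.mem_range'_1] at hj
      omega

theorem w_self (i : ℕ) : w x n i i = 1 := by simp [w]

theorem w_eq_mul {i j : ℕ} (h : i < j) : w x n i j = e x n i * w x n (i + 1) j := by
  unfold w
  rw [show j - i = (j - (i + 1)) + 1 by omega, List.range'_succ, List.map_cons, List.prod_cons]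

/-- The stair whose last down step is at j is a valley at j, with weight 1; its peak at j is the
stair with that step moved to j + 1. Each letter of e_j ⋯ e_k pushes the step along, so only the
stair descending at k + 1 contributes, with coefficient 1. -/
theorem seminormalRep_w_stair (hp : ∀ j, p x (j + 1) ≠ 0) (t : Tableau n lam) {k : ℕ}
    (hk : k + 1 ≤ n) (h0 : 1 ≤ (t.shape (k + 1)).1) (hk' : 2 * (t.shape (k + 1)).1 ≤ k + 1)
    {ψ : Tableau n lam → K}
    (hψ : ∀ h : 2 * (t.shape (k + 1)).1 ≤ k, ψ (stair t hk h (Nat.le_succ k) (Or.inl h0)) = 0)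
    (d : ℕ) : ∀ (j : ℕ) (hj : 2 * (t.shape (k + 1)).1 ≤ j) (hjk : j ≤ k + 1), j + d = k + 1 →
      seminormalRep hp lam (w x n j (k + 1)) ψ (stair t hk hj hjk (Or.inl h0))
        = ψ (stair t hk hk' le_rfl (Or.inl h0)) := by
  have wt := t.shape_weight hk
  induction d with
  | zero =>
    intro j hj hjk hd
    obtain rfl : j = k + 1 := by omega
    rw [w_self, map_one]
    rfl
  | succ d ih =>
    intro j hj hjk hd
    rw [w_eq_mul (by omega), map_mul, Module.End.mul_apply,
      seminormalRep_e hp lam (by omega) (by omega)]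
    have bs : ∀ m ≤ k + 1, (stair t hk hj hjk (Or.inl h0)).boxes m
        = stairBoxes (t.shape (k + 1)).1 j m := by
      intro m hm
      rw [boxes_stair _ _ _ _ _ (by omega)]
      unfold stairBoxes
      split_ifs <;> first | rfl | omega | (obtain rfl : m = k + 1 := (by omega); omega)
    have b1 : (stair t hk hj hjk (Or.inl h0)).boxes (j - 1) = j + 1 - 2 * (t.shape (k + 1)).1 := by
      rw [bs _ (by omega)]
      unfold stairBoxes
      split_ifs <;> omega
    have b2 : (stair t hk hj hjk (Or.inl h0)).boxes j = j - 2 * (t.shape (k + 1)).1 := by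
      rw [bs _ (by omega)]
      unfold stairBoxes
      split_ifs <;> omega
    have b3 : (stair t hk hj hjk (Or.inl h0)).boxes (j + 1) = j + 1 - 2 * (t.shape (k + 1)).1 := by
      rw [bs _ (by omega)]
      unfold stairBoxes
      split_ifs <;> omega
    have ht : (stair t hk hj hjk (Or.inl h0)).Turns j := by
      unfold Tableau.Turns
      rw [b1, b3]
    have hv : (stair t hk hj hjk (Or.inl h0)).valley j = stair t hk hj hjk (Or.inl h0) :=
      (Tableau.eq_valley (by omega) (by omega) ht (fun _ _ _ => rfl) (by omega)).symm
    have hpk : (stair t hk hj hjk (Or.inl h0)).peak j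
        = stair t hk (show 2 * (t.shape (k + 1)).1 ≤ j + 1 by omega) (by omega) (Or.inl h0) := by
      refine (Tableau.eq_peak (by omega) (by omega) ht (fun m hm hmj => ?_) ?_).symm
      · rw [boxes_stair _ _ _ _ _ hm, boxes_stair _ _ _ _ _ hm]
        unfold stairBoxes
        split_ifs <;> omega
      · rw [b1, boxes_stair _ _ _ _ _ (by omega)]
        unfold stairBoxes
        split_ifs <;> omega
    -- If the down step stays at j, the path rises to levels j + 1 and j + 2, hence does not turn at
    -- j + 1 and the next letter kills it; when no letter remains, `hψ` applies.
    have hz : seminormalRep hp lam (w x n (j + 1) (k + 1)) ψ (stair t hk hj hjk (Or.inl h0))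
        = 0 := by
      rcases Nat.eq_zero_or_pos d with rfl | hd0
      · obtain rfl : j = k := by omega
        rw [w_self, map_one]
        exact hψ hj
      · rw [w_eq_mul (by omega), map_mul, Module.End.mul_apply,
          seminormalRep_e hp lam (by omega) (by omega), seminormalOp_of_not_turns]
        unfold Tableau.Turns
        have b4 : (stair t hk hj hjk (Or.inl h0)).boxes (j + 1 + 1)
            = j + 2 - 2 * (t.shape (k + 1)).1 := by
          rw [bs _ (by omega)]
          unfold stairBoxes
          split_ifs <;> omega
        rw [b4, Nat.add_sub_cancel, b2]
        omega
    rw [seminormalOp_of_turns ht, average, hv, hz, hpk, weight, if_neg (by omega),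
      ih (j + 1) (by omega) (by omega) (by omega)]
    ring

open Classical in
-- The most dominant path that joins t at level k sees t with coefficient 1 through v_{t|k}. A down
-- step of t at level k + 1 contributes the word w that carries one stair to the stair for level k.
theorem seminormalRep_vRestr_stair (hp : ∀ j, p x (j + 1) ≠ 0) (t : Tableau n lam) (k : ℕ) :
    ∀ (hk : k ≤ n) (hk' : 2 * (t.shape k).1 ≤ k),
      seminormalRep hp lam (vRestr x t k) (Pi.single t 1)
        (stair t hk le_rfl hk' (by omega)) = 1 := by
  induction k with
  | zero =>
    intro hk hk'
    have : stair t hk le_rfl hk' (by omega) = t := by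
      refine Tableau.ext_boxes fun m hm => ?_
      rw [boxes_stair _ _ _ _ _ hm, if_neg (by omega)]
    rw [this, vRestr, map_one, Module.End.one_apply, Pi.single_eq_same]
  | succ k ih =>
    intro hk hk'
    have w1 := t.shape_weight hk
    have w2 := t.shape_weight (k := k) (by omega)
    have st := t.boxes_step (k := k) (by omega)
    have ihk := ih (by omega) (by omega)
    rw [vRestr]
    split_ifs with h
    · have : stair t hk le_rfl hk' (by omega) = stair t (k := k) (by omega) le_rfl (by omega)
          (by omega) := by
        refine Tableau.ext_boxes fun m hm => ?_
        rw [boxes_stair _ _ _ _ _ hm, boxes_stair _ _ _ _ _ hm, h]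
        unfold stairBoxes
        split_ifs <;> first | rfl | omega | (obtain rfl : m = k := (by omega); omega)
      rw [this]
      exact ihk
    · have h0 : 1 ≤ (t.shape (k + 1)).1 := by omega
      rw [map_mul, Module.End.mul_apply, seminormalRep_w_stair hp t hk h0 hk' ?_
        (k + 1 - 2 * (t.shape (k + 1)).1) _ le_rfl hk' (by omega)]
      · have : stair t hk hk' le_rfl (Or.inl h0) = stair t (k := k) (by omega) le_rfl (by omega)
            (by omega) := by
          refine Tableau.ext_boxes fun m hm => ?_
          rw [boxes_stair _ _ _ _ _ hm, boxes_stair _ _ _ _ _ hm]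
          have h1 : (t.shape (k + 1)).1 = (t.shape k).1 + 1 := by omega
          rw [h1]
          unfold stairBoxes
          split_ifs <;> first | rfl | omega | (obtain rfl : m = k := (by omega); omega)
        rw [this]
        exact ihk
      · intro h2
        refine seminormalRep_vRestr_support hp t (k := k) (c := t.boxes k) (by omega) le_rfl ?_ _ ?_
        · intro u hu
          rw [Pi.single_apply, if_neg]
          rintro rfl
          exact hu rfl
        · rw [boxes_stair _ _ _ _ _ (by omega)]
          unfold stairBoxes
          split_ifs <;> omega

theorem mPart_zero (c : ℕ) : mPart x n (0, c) = 1 := by simp [mPart]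

theorem mPart_succ (g c d : ℕ) :
    mPart x n (g + 1, c) = mPart x n (g, d) * e x n (2 * g + 1) := by
  simp [mPart, List.range_succ]

/-- At a path of height 0 at level 2g, the generator e_{2g+1} sees only a peak and is multiplication
by x if the path returns to 0 at level 2g + 2, and zero otherwise. -/
theorem seminormalRep_mPart_apply (hp : ∀ j, p x (j + 1) ≠ 0) (g c : ℕ) (hg : 2 * g ≤ n)
    (φ : Tableau n lam → K) (t : Tableau n lam) :
    seminormalRep hp lam (mPart x n (g, c)) φ t
      = if ∀ j ≤ g, t.boxes (2 * j) = 0 then x ^ g * φ t else 0 := by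
  induction g generalizing c φ with
  | zero =>
    rw [mPart_zero, map_one, if_pos]
    · simp
    · intro j hj
      obtain rfl : j = 0 := by omega
      exact t.boxes_zero
  | succ g ih =>
    rw [mPart_succ g c c, map_mul, Module.End.mul_apply, ih c (by omega),
      seminormalRep_e hp lam (by omega) (by omega)]
    by_cases h : ∀ j ≤ g, t.boxes (2 * j) = 0
    · rw [if_pos h]
      have hg0 := h g le_rfl
      by_cases h2 : t.boxes (2 * (g + 1)) = 0
      · rw [if_pos]
        · have ht : t.Turns (2 * g + 1) := by
            unfold Tableau.Turns
            rw [Nat.add_sub_cancel, hg0]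
            exact h2.symm
          have hb := t.boxes_step (k := 2 * g) (by omega)
          have hb1 : t.boxes (2 * g + 1) = t.boxes (2 * g + 1 - 1) + 1 := by
            rw [Nat.add_sub_cancel]; omega
          rw [seminormalOp_of_turns ht, average, weight, if_pos hb1,
            ← Tableau.eq_peak (by omega) (by omega) ht (fun _ _ _ => rfl) hb1,
            Nat.add_sub_cancel, hg0, p_zero, zero_add, zero_add, p_two, p_one]
          ring
        · intro j hj
          rcases Nat.lt_or_ge g j with hgj | hgj
          · obtain rfl : j = g + 1 := by omega
            exact h2
          · exact h j hgj
      · rw [if_neg fun h' => h2 (h' (g + 1) le_rfl), seminormalOp_of_not_turns, mul_zero]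
        unfold Tableau.Turns
        rw [Nat.add_sub_cancel, hg0]
        exact fun h' => h2 h'.symm
    · rw [if_neg h, if_neg fun h' => h fun j hj => h' j (by omega)]

/-- The seminormal representation of shape `lam` kills the ideal of the higher shapes. -/
theorem seminormalRep_eq_zero_of_mem (hp : ∀ j, p x (j + 1) ≠ 0) {a : TL K x n}
    (ha : a ∈ higherIdeal x n lam) : seminormalRep hp lam a = 0 := by
  have h : higherIdeal x n lam ≤ TwoSidedIdeal.ker (seminormalRep hp lam (n := n)) := by
    unfold higherIdeal
    rw [TwoSidedIdeal.span_le]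
    rintro _ ⟨⟨g, c⟩, hmu, hlt, rfl⟩
    rw [SetLike.mem_coe, TwoSidedIdeal.mem_ker]
    have hg : 2 * g ≤ n := by
      unfold partitions at hmu
      rw [Finset.mem_image] at hmu
      obtain ⟨i, hi, hi2⟩ := hmu
      rw [Finset.mem_range] at hi
      have := congrArg Prod.fst hi2
      simp only at this
      omega
    refine LinearMap.ext fun φ => funext fun t => ?_
    rw [seminormalRep_mPart_apply hp g c hg, if_neg]
    · rfl
    · intro h
      -- A path surviving m_μ has first entry g at level 2g, and first entries never decrease, so
      -- the final one is at least g, against μ ▷ λ.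
      have mono : ∀ d, 2 * g + d ≤ n → g ≤ (t.shape (2 * g + d)).1 := by
        intro d
        induction d with
        | zero =>
          intro hd
          have w := t.shape_weight hd
          have := h g le_rfl
          rw [add_zero] at w ⊢
          omega
        | succ d ih =>
          intro hd
          have w := t.shape_weight hd
          have w' := t.shape_weight (k := 2 * g + d) (by omega)
          have := t.boxes_step (k := 2 * g + d) (by omega)
          have := ih (by omega)
          rw [← add_assoc] at *
          omega
      have := mono (n - 2 * g) (by omega)
      rw [show 2 * g + (n - 2 * g) = n by omega, t.shape_self] at this
      simp only at hlt
      omega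
  exact (TwoSidedIdeal.mem_ker _).1 (h ha)

/-- F_t reduces φ to φ(t) times the indicator of t, v_t carries this to the value φ(t) at the top
tableau, and m_λ multiplies by x^f there. This dual pairing identifies f_t with the coordinate t. -/
theorem seminormalRep_murphy_apply (hp : ∀ j, p x (j + 1) ≠ 0) (hlam : 2 * lam.1 + lam.2 = n)
    (t : Tableau n lam) (φ : Tableau n lam → K) :
    seminormalRep hp lam (mPart x n lam * vRestr x t n * idem x t) φ (topTableau hlam)
      = x ^ lam.1 * φ t := by
  classical
  rw [mul_assoc, map_mul, map_mul, Module.End.mul_apply, Module.End.mul_apply,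
    seminormalRep_mPart_apply hp lam.1 lam.2 (by omega), if_pos]
  · congr 1
    have h1 : seminormalRep hp lam (idem x t) φ = φ t • Pi.single t (1 : K) := by
      funext s
      rw [seminormalRep_idem_apply, Pi.smul_apply, Pi.single_apply]
      split_ifs with h
      · rw [h]; simp
      · simp
    have hs := t.shape_self
    have h2 : topTableau hlam
        = stair t le_rfl le_rfl (show 2 * (t.shape n).1 ≤ n by rw [hs]; omega) (by omega) := by
      refine Tableau.ext_boxes fun m hm => ?_
      rw [boxes_topTableau hlam hm, boxes_stair _ _ _ _ _ hm, hs]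
      split_ifs with h
      · rfl
      · obtain rfl : m = n := by omega
        rw [t.boxes_self]
        unfold stairBoxes
        split_ifs <;> omega
    rw [h1, map_smul, Pi.smul_apply, h2, seminormalRep_vRestr_stair hp t n, smul_eq_mul, mul_one]
  · intro j hj
    rw [boxes_topTableau hlam (by omega)]
    unfold stairBoxes
    split_ifs <;> omega

end Leading

/-! ### Reduction of words in the generators -/

section Jones

variable {K : Type} [Field K] {B : Type} [Ring B] [Algebra K B]

theorem mul_mem_of_mem_adjoin {s : Set B} {U : Submodule K B}
    (hU : ∀ u ∈ U, ∀ y ∈ s, u * y ∈ U) {a : B} (ha : a ∈ Algebra.adjoin K s) :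
    ∀ u ∈ U, u * a ∈ U := by
  induction ha using Algebra.adjoin_induction with
  | mem y hy => exact fun u hu => hU u hu y hy
  | algebraMap c =>
    intro u hu
    rw [← Algebra.commutes, ← Algebra.smul_def]
    exact U.smul_mem c hu
  | add a b _ _ iha ihb => intro u hu; rw [mul_add]; exact U.add_mem (iha u hu) (ihb u hu)
  | mul a b _ _ iha ihb => intro u hu; rw [← mul_assoc]; exact ihb _ (iha u hu)

variable {x : K} {g : ℕ → B} {m : ℕ}

/-- For generators satisfying the Temperley–Lieb relations, a word in `g_j, g_{j+1}, …` between
two letters `g_j` can be replaced by one in `g_{j+2}, …` after a single `g_j`. -/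
theorem exists_mul_mul_eq (hsq : ∀ i < m, g i * g i = x • g i)
    (hadj : ∀ i, i + 1 < m → g i * g (i + 1) * g i = g i)
    (hcomm : ∀ i j, i + 2 ≤ j → j < m → g i * g j = g j * g i) (d : ℕ) :
    ∀ j, j + d + 1 = m → ∀ a ∈ Algebra.adjoin K (g '' Set.Ico (j + 1) m),
      ∃ b ∈ Algebra.adjoin K (g '' Set.Ico (j + 2) m), g j * a * g j = g j * b := by
  have comm : ∀ j, ∀ a ∈ Algebra.adjoin K (g '' Set.Ico (j + 2) m), Commute (g j) a := by
    intro j a ha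
    refine Algebra.commute_of_mem_adjoin_of_forall_mem_commute ha ?_
    rintro _ ⟨i, hi, rfl⟩
    exact hcomm j i hi.1 hi.2
  have base : ∀ j < m, ∀ a ∈ Algebra.adjoin K (g '' Set.Ico (j + 2) m),
      ∃ b ∈ Algebra.adjoin K (g '' Set.Ico (j + 2) m), g j * a * g j = g j * b := by
    intro j hj a ha
    refine ⟨x • a, Subalgebra.smul_mem _ ha x, ?_⟩
    rw [(comm j a ha).eq, mul_assoc, hsq j hj, mul_smul_comm, mul_smul_comm, (comm j a ha).eq]
  induction d with
  | zero =>
    intro j hj a ha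
    have h1 : Set.Ico (j + 1) m = Set.Ico (j + 2) m := by
      ext i; simp only [Set.mem_Ico]; omega
    rw [h1] at ha
    exact base j (by omega) a ha
  | succ d ih =>
    intro j hj a ha
    have ihj := ih (j + 1) (by omega)
    let S := Algebra.adjoin K (g '' Set.Ico (j + 2) m)
    have hS3 : Algebra.adjoin K (g '' Set.Ico (j + 1 + 2) m) ≤ S :=
      Algebra.adjoin_mono (Set.image_mono (Set.Ico_subset_Ico_left (by omega)))
    -- By induction two letters g_{j+1} merge into one, so words in g_{j+1}, g_{j+2}, … need at most
    -- one of them; everything else commutes with g_j, and g_j g_{j+1} g_j = g_j finishes.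
    let U : Submodule K B := Submodule.span K
      {c | c ∈ S ∨ ∃ s ∈ S, ∃ s' ∈ S, c = s * g (j + 1) * s'}
    have hU : ∀ u ∈ U, ∀ y ∈ g '' Set.Ico (j + 1) m, u * y ∈ U := by
      rintro u hu _ ⟨i, hi, rfl⟩
      induction hu using Submodule.span_induction with
      | zero => rw [zero_mul]; exact U.zero_mem
      | add u v _ _ hu hv => rw [add_mul]; exact U.add_mem hu hv
      | smul c u _ hu => rw [smul_mul_assoc]; exact U.smul_mem c hu
      | mem u hu =>
        refine Submodule.subset_span ?_
        by_cases hij : i = j + 1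
        · subst hij
          rcases hu with hu | ⟨s, hs, s', hs', rfl⟩
          · exact Or.inr ⟨u, hu, 1, S.one_mem, by rw [mul_one]⟩
          · obtain ⟨b, hb, e⟩ := ihj s' hs'
            exact Or.inr ⟨s, hs, b, hS3 hb, by rw [mul_assoc s, mul_assoc s, e, mul_assoc]⟩
        · have hgi : g i ∈ S :=
            Algebra.subset_adjoin ⟨i, ⟨by have := hi.1; omega, hi.2⟩, rfl⟩
          rcases hu with hu | ⟨s, hs, s', hs', rfl⟩
          · exact Or.inl (S.mul_mem hu hgi)
          · exact Or.inr ⟨s, hs, s' * g i, S.mul_mem hs' hgi, by rw [mul_assoc]⟩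
    have haU : a ∈ U := by
      have := mul_mem_of_mem_adjoin hU ha 1 (Submodule.subset_span (Or.inl S.one_mem))
      rwa [one_mul] at this
    clear ha
    induction haU using Submodule.span_induction with
    | zero => exact ⟨0, S.zero_mem, by simp⟩
    | add u v _ _ hu hv =>
      obtain ⟨b, hb, e⟩ := hu
      obtain ⟨b', hb', e'⟩ := hv
      exact ⟨b + b', S.add_mem hb hb', by rw [mul_add, add_mul, e, e', mul_add]⟩
    | smul c u _ hu =>
      obtain ⟨b, hb, e⟩ := hu
      exact ⟨c • b, S.smul_mem hb c, by rw [mul_smul_comm, smul_mul_assoc, e, mul_smul_comm]⟩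
    | mem u hu =>
      rcases hu with hu | ⟨s, hs, s', hs', rfl⟩
      · exact base j (by omega) u hu
      · refine ⟨s * s', S.mul_mem hs hs', ?_⟩
        calc g j * (s * g (j + 1) * s') * g j
            = (g j * s) * g (j + 1) * (s' * g j) := by simp only [mul_assoc]
          _ = s * (g j * g (j + 1) * g j) * s' := by
              rw [(comm j s hs).eq, ← (comm j s' hs').eq]; simp only [mul_assoc]
          _ = g j * (s * s') := by
              rw [hadj j (by omega), ← (comm j s hs).eq, mul_assoc]

end Jones

/-! ### Normal forms of words modulo longer products e_1 e_3 ⋯ -/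

section Words

variable {K : Type} [Field K] (x : K) (n : ℕ)

variable {x n} in
theorem e_mul_self {i : ℕ} (hi : 1 ≤ i) (hin : i < n) : e x n i * e x n i = x • e x n i := by
  rw [e, dif_pos ⟨hi, hin⟩, ← map_mul, RingQuot.mkAlgHom_rel K (Rel.sq ⟨i, hi, hin⟩), map_smul]

variable {x n} in
theorem e_mul_mul_self {i j : ℕ} (hi : 1 ≤ i) (hin : i < n) (hj : 1 ≤ j) (hjn : j < n)
    (h : i + 1 = j ∨ j + 1 = i) : e x n i * e x n j * e x n i = e x n i := by
  rw [e, dif_pos ⟨hi, hin⟩, e, dif_pos ⟨hj, hjn⟩, ← map_mul, ← map_mul,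
    RingQuot.mkAlgHom_rel K (Rel.adjacent ⟨i, hi, hin⟩ ⟨j, hj, hjn⟩ h)]

variable {x n} in
theorem e_commute {i j : ℕ} (h : i + 2 ≤ j ∨ j + 2 ≤ i) : Commute (e x n i) (e x n j) := by
  by_cases hi : 1 ≤ i ∧ i < n
  · by_cases hj : 1 ≤ j ∧ j < n
    · rw [commute_iff_eq, e, dif_pos hi, e, dif_pos hj, ← map_mul, ← map_mul,
        RingQuot.mkAlgHom_rel K (Rel.distant ⟨i, hi⟩ ⟨j, hj⟩ h)]
    · rw [e_eq_zero hj]; exact Commute.zero_right _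
  · rw [e_eq_zero hi]; exact Commute.zero_left _

/-- The subalgebra generated by `e_a, …, e_{b-1}`. -/
def rangeAlg (a b : ℕ) : Subalgebra K (TL K x n) := Algebra.adjoin K (e x n '' Set.Ico a b)

variable {x n}

theorem e_mem_rangeAlg {a b i : ℕ} (ha : a ≤ i) (hb : i < b) : e x n i ∈ rangeAlg x n a b :=
  Algebra.subset_adjoin ⟨i, ⟨ha, hb⟩, rfl⟩

theorem rangeAlg_mono {a b a' b' : ℕ} (ha : a' ≤ a) (hb : b ≤ b') :
    rangeAlg x n a b ≤ rangeAlg x n a' b' :=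
  Algebra.adjoin_mono (Set.image_mono (Set.Ico_subset_Ico ha hb))

theorem commute_of_mem_rangeAlg {a b : ℕ} {y z : TL K x n} (hz : z ∈ rangeAlg x n a b)
    (h : ∀ i, a ≤ i → i < b → Commute y (e x n i)) : Commute y z := by
  refine Algebra.commute_of_mem_adjoin_of_forall_mem_commute hz ?_
  rintro _ ⟨i, hi, rfl⟩
  exact h i hi.1 hi.2

theorem exists_e_mul_e_of_lt {k : ℕ} (hk : 1 ≤ k) (hkn : k < n) {a : TL K x n}
    (ha : a ∈ rangeAlg x n 1 k) :
    ∃ b ∈ rangeAlg x n 1 (k - 1), e x n k * a * e x n k = e x n k * b := by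
  -- The relations are symmetric under reversing the order of the generators, so the abstract lemma
  -- is applied to e_k, e_{k-1}, …, e_1.
  have key := exists_mul_mul_eq (K := K) (x := x) (g := fun i => e x n (k - i)) (m := k)
    (fun i hi => e_mul_self (by omega) (by omega))
    (fun i hi => e_mul_mul_self (by omega) (by omega) (by omega) (by omega) (by omega))
    (fun i j hij hj => (e_commute (by omega)).eq) (k - 1) 0 (by omega) a
  have conv : ∀ l, (fun i => e x n (k - i)) '' Set.Ico (l + 1) k = e x n '' Set.Ico 1 (k - l) := by
    intro l
    ext y
    constructor
    · rintro ⟨i, ⟨h1, h2⟩, rfl⟩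
      exact ⟨k - i, ⟨by omega, by omega⟩, rfl⟩
    · rintro ⟨i, ⟨h1, h2⟩, rfl⟩
      refine ⟨k - i, ⟨by omega, by omega⟩, ?_⟩
      simp only
      rw [show k - (k - i) = i by omega]
  rw [conv 0, conv 1] at key
  exact key ha

theorem exists_e_mul_e_of_gt {k N : ℕ} (hk : 1 ≤ k) (hkN : k < N) (hN : N ≤ n) {a : TL K x n}
    (ha : a ∈ rangeAlg x n k N) :
    ∃ b ∈ rangeAlg x n (k + 2) N, e x n k * a * e x n k = e x n k * b := by
  have key := exists_mul_mul_eq (K := K) (x := x) (g := fun i => e x n (k + i)) (m := N - k)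
    (fun i hi => e_mul_self (by omega) (by omega))
    (fun i hi => e_mul_mul_self (by omega) (by omega) (by omega) (by omega) (by omega))
    (fun i j hij hj => (e_commute (by omega)).eq) (N - k - 1) 0 (by omega)
  have conv : ∀ l, (fun i => e x n (k + i)) '' Set.Ico l (N - k)
      = e x n '' Set.Ico (k + l) N := by
    intro l
    ext y
    constructor
    · rintro ⟨i, ⟨h1, h2⟩, rfl⟩
      exact ⟨k + i, ⟨by omega, by omega⟩, rfl⟩
    · rintro ⟨i, ⟨h1, h2⟩, rfl⟩
      refine ⟨i - k, ⟨by omega, by omega⟩, ?_⟩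
      simp only
      rw [show k + (i - k) = i by omega]
  rw [conv, conv] at key
  simp only [zero_add, add_zero] at key
  -- `e_k a` can be written with a single `e_k`
  have hU : e x n k * a ∈ (Subalgebra.toSubmodule (rangeAlg x n (k + 1) N)).map
      (LinearMap.mulLeft K (e x n k)) := by
    refine mul_mem_of_mem_adjoin ?_ ha _ ⟨1, one_mem (rangeAlg x n (k + 1) N), by simp⟩
    rintro _ ⟨c, hc, rfl⟩ _ ⟨i, hi, rfl⟩
    rcases Nat.eq_or_lt_of_le hi.1 with rfl | hki
    · obtain ⟨b, hb, e1⟩ := key c hc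
      exact ⟨b, rangeAlg_mono (by omega) le_rfl hb, e1.symm⟩
    · exact ⟨c * e x n i, (rangeAlg x n (k + 1) N).mul_mem hc (e_mem_rangeAlg hki hi.2), by simp [mul_assoc]⟩
  obtain ⟨c, hc, e1⟩ := hU
  rw [LinearMap.mulLeft_apply] at e1
  obtain ⟨b, hb, e2⟩ := key c hc
  exact ⟨b, hb, by rw [← e1, e2]⟩

/-- The span of the products `a y b` with `a, b ∈ S` (zero if the condition `P` fails). -/
def sandwich (P : Prop) (S : Subalgebra K (TL K x n)) (y : TL K x n) : Submodule K (TL K x n) :=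
  Submodule.span K {c | P ∧ ∃ a ∈ S, ∃ b ∈ S, c = a * y * b}

section Sandwich

variable {P : Prop} {S : Subalgebra K (TL K x n)} {y : TL K x n}

theorem mul_mul_mem_sandwich (hP : P) {a b : TL K x n} (ha : a ∈ S) (hb : b ∈ S) :
    a * y * b ∈ sandwich P S y := Submodule.subset_span ⟨hP, a, ha, b, hb, rfl⟩

theorem sandwich_le {U : Submodule K (TL K x n)}
    (h : P → ∀ a ∈ S, ∀ b ∈ S, a * y * b ∈ U) : sandwich P S y ≤ U := by
  refine Submodule.span_le.2 ?_
  rintro _ ⟨hP, a, ha, b, hb, rfl⟩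
  exact h hP a ha b hb

theorem mul_mem_sandwich {u s : TL K x n} (hu : u ∈ sandwich P S y) (hs : s ∈ S) :
    u * s ∈ sandwich P S y := by
  have : sandwich P S y ≤ (sandwich P S y).comap (LinearMap.mulRight K s) := by
    refine sandwich_le fun hP a ha b hb => ?_
    rw [Submodule.mem_comap, LinearMap.mulRight_apply, mul_assoc]
    exact mul_mul_mem_sandwich hP ha (mul_mem hb hs)
  exact this hu

theorem mul_mem_sandwich_left {u s : TL K x n} (hu : u ∈ sandwich P S y) (hs : s ∈ S) :
    s * u ∈ sandwich P S y := by
  have : sandwich P S y ≤ (sandwich P S y).comap (LinearMap.mulLeft K s) := by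
    refine sandwich_le fun hP a ha b hb => ?_
    rw [Submodule.mem_comap, LinearMap.mulLeft_apply, ← mul_assoc, ← mul_assoc]
    exact mul_mul_mem_sandwich hP (mul_mem hs ha) hb
  exact this hu

theorem sandwich_mono {P' : Prop} {S' : Subalgebra K (TL K x n)} (hP : P → P') (hS : S ≤ S') :
    sandwich P S y ≤ sandwich P' S' y :=
  sandwich_le fun h _ ha _ hb => mul_mul_mem_sandwich (hP h) (hS ha) (hS hb)

theorem mem_sandwich_self (hP : P) : y ∈ sandwich P S y := by
  have := mul_mul_mem_sandwich (y := y) hP (one_mem S) (one_mem S)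
  rwa [one_mul, mul_one] at this

end Sandwich

/-- From e_{i+1} = e_{i+1} e_i e_{i+1} and commutation, y e_{i+1} = e_{i+1} (y e_i) e_{i+1}; the
index thus descends to a. -/
theorem mul_e_mem_sandwich {P : Prop} {a i N : ℕ} {y : TL K x n} (hP : P) (ha : 1 ≤ a)
    (hai : a ≤ i) (hiN : i < N) (hN : N ≤ n) (hy : ∀ j, a ≤ j → Commute y (e x n j))
    {S : Subalgebra K (TL K x n)} (hS : rangeAlg x n a N ≤ S) :
    y * e x n i ∈ sandwich P S (y * e x n a) := by
  induction i, hai using Nat.le_induction with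
  | base => exact mem_sandwich_self hP
  | succ i hai ih =>
    have h := e_mul_mul_self (x := x) (n := n) (i := i + 1) (j := i) (by omega) (by omega)
      (by omega) (by omega) (by omega)
    have he := hS (e_mem_rangeAlg (x := x) (n := n) (i := i + 1) (by omega) hiN)
    rw [← h, ← mul_assoc, ← mul_assoc, (hy (i + 1) (by omega)).eq, mul_assoc (e x n (i + 1))]
    exact mul_mem_sandwich (mul_mem_sandwich_left (ih (by omega)) he) he

variable (x n) in
/-- `e_{2j+1} e_{2j+3} ⋯`, with `d` factors. -/
def oddProd (j d : ℕ) : TL K x n := ((List.range' j d).map fun i => e x n (2 * i + 1)).prod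

theorem oddProd_zero (j : ℕ) : oddProd x n j 0 = 1 := by simp [oddProd]

theorem oddProd_succ (j d : ℕ) :
    oddProd x n j (d + 1) = e x n (2 * j + 1) * oddProd x n (j + 1) d := by
  simp [oddProd, List.range'_succ]

theorem oddProd_succ' (j d : ℕ) :
    oddProd x n j (d + 1) = oddProd x n j d * e x n (2 * (j + d) + 1) := by
  simp [oddProd, List.range'_1_concat]

theorem oddProd_commute {j d i : ℕ} (h : i + 2 ≤ 2 * j + 1 ∨ 2 * (j + d) + 1 ≤ i) :
    Commute (e x n i) (oddProd x n j d) := by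
  induction d with
  | zero => rw [oddProd_zero]; exact Commute.one_right _
  | succ d ih =>
    rw [oddProd_succ']
    exact (ih (by omega)).mul_right (e_commute (by omega))

theorem oddProd_mul_self {d : ℕ} (hd : 2 * d ≤ n) :
    oddProd x n 0 d * oddProd x n 0 d = x ^ d • oddProd x n 0 d := by
  induction d with
  | zero => simp [oddProd_zero]
  | succ d ih =>
    have hc : Commute (e x n (2 * (0 + d) + 1)) (oddProd x n 0 d) := oddProd_commute (by omega)
    rw [oddProd_succ', mul_assoc, ← mul_assoc (e x n _), hc.eq, mul_assoc, ← mul_assoc,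
      e_mul_self (by omega) (by omega), ih (by omega), mul_smul_comm, smul_mul_assoc, smul_smul]
    congr 1
    ring

/-- The algebra squeezed between two copies of `e_{2j+1} e_{2j+3} ⋯` consists of multiples of this
element, modulo longer such products. -/
theorem oddProd_mul_mul_oddProd {N : ℕ} (hN : N ≤ n) (d : ℕ) :
    ∀ j, 2 * (j + d) ≤ N → ∀ a ∈ rangeAlg x n (2 * j + 1) N,
      oddProd x n j d * a * oddProd x n j d ∈ Submodule.span K {oddProd x n j d}
        ⊔ sandwich (2 * (j + d) + 2 ≤ N) (rangeAlg x n (2 * j + 1) N) (oddProd x n j (d + 1)) := by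
  induction d with
  | zero =>
    intro j hj a ha
    rw [oddProd_zero, one_mul, mul_one, oddProd_succ, oddProd_zero]
    rw [← one_mul a]
    refine mul_mem_of_mem_adjoin ?_ ha 1
      (Submodule.mem_sup_left (Submodule.mem_span_singleton_self 1))
    rintro u hu _ ⟨i, hi, rfl⟩
    refine Submodule.mem_sup_right ?_
    obtain ⟨v, hv, s, hs, rfl⟩ := Submodule.mem_sup.1 hu
    obtain ⟨c, rfl⟩ := Submodule.mem_span_singleton.1 hv
    rw [add_mul]
    refine add_mem ?_ (mul_mem_sandwich hs (e_mem_rangeAlg hi.1 hi.2))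
    rw [smul_mul_assoc, mul_one (e x n (2 * j + 1))]
    refine Submodule.smul_mem _ _ ?_
    rw [← one_mul (e x n (2 * j + 1))]
    exact mul_e_mem_sandwich (by have := hi.1; have := hi.2; omega) (by omega) hi.1 hi.2 hN
      (fun _ _ => Commute.one_left _) le_rfl
  | succ d ih =>
    intro j hj a ha
    have hc : Commute (e x n (2 * j + 1)) (oddProd x n (j + 1) d) := oddProd_commute (by omega)
    obtain ⟨b, hb, hab⟩ := exists_e_mul_e_of_gt (k := 2 * j + 1) (by omega) (by omega) hN ha
    have h := ih (j + 1) (by omega) b (by rwa [show 2 * (j + 1) + 1 = 2 * j + 1 + 2 by ring])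
    have e1 : oddProd x n j (d + 1) * a * oddProd x n j (d + 1)
        = e x n (2 * j + 1) * (oddProd x n (j + 1) d * b * oddProd x n (j + 1) d) := by
      rw [oddProd_succ]
      calc e x n (2 * j + 1) * oddProd x n (j + 1) d * a
            * (e x n (2 * j + 1) * oddProd x n (j + 1) d)
          = oddProd x n (j + 1) d * e x n (2 * j + 1) * a
            * (e x n (2 * j + 1) * oddProd x n (j + 1) d) := by rw [← hc.eq]
        _ = oddProd x n (j + 1) d * (e x n (2 * j + 1) * a * e x n (2 * j + 1))
            * oddProd x n (j + 1) d := by simp only [mul_assoc]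
        _ = _ := by rw [hab, ← mul_assoc (oddProd x n (j + 1) d), ← hc.eq]; simp only [mul_assoc]
    rw [e1]
    obtain ⟨v, hv, s, hs, hvs⟩ := Submodule.mem_sup.1 h
    obtain ⟨c, rfl⟩ := Submodule.mem_span_singleton.1 hv
    rw [← hvs, mul_add (e x n _), mul_smul_comm, ← oddProd_succ]
    refine add_mem (Submodule.mem_sup_left (Submodule.smul_mem _ _
      (Submodule.mem_span_singleton_self _))) (Submodule.mem_sup_right ?_)
    have hle : sandwich (2 * (j + 1 + d) + 2 ≤ N) (rangeAlg x n (2 * (j + 1) + 1) N)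
        (oddProd x n (j + 1) (d + 1)) ≤ (sandwich (2 * (j + (d + 1)) + 2 ≤ N)
        (rangeAlg x n (2 * j + 1) N) (oddProd x n j (d + 1 + 1))).comap
          (LinearMap.mulLeft K (e x n (2 * j + 1))) := by
      refine sandwich_le fun hP a ha b hb => ?_
      have hca : Commute (e x n (2 * j + 1)) a :=
        commute_of_mem_rangeAlg ha fun i h1 _ => e_commute (by omega)
      rw [Submodule.mem_comap, LinearMap.mulLeft_apply, ← mul_assoc, ← mul_assoc, hca.eq,
        mul_assoc a, ← oddProd_succ]
      exact mul_mul_mem_sandwich (by omega) (rangeAlg_mono (by omega) le_rfl ha)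
        (rangeAlg_mono (by omega) le_rfl hb)
    exact hle hs

end Words

/-! ### The Murphy basis spans the cell module -/

section Spanning

variable {K : Type} [Field K] {x : K} {n : ℕ}

theorem w_succ {i j : ℕ} (h : i ≤ j) : w x n i (j + 1) = w x n i j * e x n j := by
  unfold w
  rw [show j + 1 - i = j - i + 1 by omega, List.range'_1_concat, List.map_append, List.prod_append,
    show i + (j - i) = j by omega]
  simp

theorem w_mem {i j b : ℕ} (hi : 1 ≤ i) (hj : j ≤ b) : w x n i j ∈ rangeAlg x n 1 b := by
  refine list_prod_mem fun y hy => ?_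
  rw [List.mem_map] at hy
  obtain ⟨k, hk, rfl⟩ := hy
  rw [List.mem_range'_1] at hk
  exact e_mem_rangeAlg (by omega) (by omega)

theorem oddProd_commute_w {g i j : ℕ} (hi : 2 * g + 1 ≤ i) :
    Commute (oddProd x n 0 g) (w x n i j) := by
  refine Commute.list_prod_right _ _ fun y hy => ?_
  rw [List.mem_map] at hy
  obtain ⟨k, hk, rfl⟩ := hy
  rw [List.mem_range'_1] at hk
  exact (oddProd_commute (by omega)).symm

/-- The last letter of e_1 e_3 ⋯ e_{2g+1} joins w, and the remaining product commutes with the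
longer word. This exposes the product with one factor fewer, to which induction on the number of
strands applies. -/
theorem oddProd_mul_w {g k : ℕ} (hk : 2 * g + 1 < k) :
    oddProd x n 0 (g + 1) * w x n (2 * (g + 1)) k = w x n (2 * g + 1) k * oddProd x n 0 g := by
  rw [← (oddProd_commute_w le_rfl).eq, w_eq_mul hk, oddProd_succ', zero_add, mul_assoc]
  rfl

/-- Right multiples of `e_1 e_3 ⋯ e_{2g+1}` by the first generators can be written with the last
generator only at a prescribed place. -/
theorem oddProd_mul_mem {g m : ℕ} (hm : 2 * g + 1 ≤ m) :
    m < n → ∀ a ∈ rangeAlg x n 1 (m + 1), oddProd x n 0 (g + 1) * a ∈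
      (Subalgebra.toSubmodule (rangeAlg x n 1 m)).map (LinearMap.mulLeft K (oddProd x n 0 (g + 1)))
      ⊔ (Subalgebra.toSubmodule (rangeAlg x n 1 m)).map
        (LinearMap.mulLeft K (oddProd x n 0 (g + 1) * w x n (2 * (g + 1)) (m + 1)))
      ⊔ sandwich (2 * (g + 1) + 2 ≤ m + 1) (rangeAlg x n 1 (m + 1)) (oddProd x n 0 (g + 2)) := by
  -- it suffices to treat right multiplication of the first summand by `e_m`
  have reduce : ∀ m, 2 * g + 1 ≤ m → m < n →
      (∀ c ∈ rangeAlg x n 1 m, oddProd x n 0 (g + 1) * c * e x n m ∈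
        (Subalgebra.toSubmodule (rangeAlg x n 1 m)).map
          (LinearMap.mulLeft K (oddProd x n 0 (g + 1)))
        ⊔ (Subalgebra.toSubmodule (rangeAlg x n 1 m)).map
          (LinearMap.mulLeft K (oddProd x n 0 (g + 1) * w x n (2 * (g + 1)) (m + 1)))
        ⊔ sandwich (2 * (g + 1) + 2 ≤ m + 1) (rangeAlg x n 1 (m + 1)) (oddProd x n 0 (g + 2))) →
      ∀ a ∈ rangeAlg x n 1 (m + 1), oddProd x n 0 (g + 1) * a ∈
        (Subalgebra.toSubmodule (rangeAlg x n 1 m)).map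
          (LinearMap.mulLeft K (oddProd x n 0 (g + 1)))
        ⊔ (Subalgebra.toSubmodule (rangeAlg x n 1 m)).map
          (LinearMap.mulLeft K (oddProd x n 0 (g + 1) * w x n (2 * (g + 1)) (m + 1)))
        ⊔ sandwich (2 * (g + 1) + 2 ≤ m + 1) (rangeAlg x n 1 (m + 1)) (oddProd x n 0 (g + 2)) := by
    intro m hm hmn H a ha
    refine mul_mem_of_mem_adjoin ?_ ha _ (Submodule.mem_sup_left (Submodule.mem_sup_left
      ⟨1, one_mem (rangeAlg x n 1 m), by simp⟩))
    rintro u hu _ ⟨i, hi, rfl⟩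
    obtain ⟨u', hu', s, hs, rfl⟩ := Submodule.mem_sup.1 hu
    obtain ⟨_, ⟨c, hc, rfl⟩, _, ⟨c', hc', rfl⟩, rfl⟩ := Submodule.mem_sup.1 hu'
    simp only [LinearMap.mulLeft_apply, add_mul]
    refine add_mem (add_mem ?_ ?_)
      (Submodule.mem_sup_right (mul_mem_sandwich hs (e_mem_rangeAlg hi.1 hi.2)))
    · rcases Nat.lt_or_ge i m with him | him
      · exact Submodule.mem_sup_left (Submodule.mem_sup_left ⟨c * e x n i,
          (rangeAlg x n 1 m).mul_mem hc (e_mem_rangeAlg hi.1 him), by simp [mul_assoc]⟩)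
      · obtain rfl : i = m := by have := hi.2; omega
        exact H c hc
    · rcases Nat.lt_or_ge i m with him | him
      · exact Submodule.mem_sup_left (Submodule.mem_sup_right ⟨c' * e x n i,
          (rangeAlg x n 1 m).mul_mem hc' (e_mem_rangeAlg hi.1 him), by simp [mul_assoc]⟩)
      · obtain rfl : i = m := by have := hi.2; omega
        rcases Nat.eq_or_lt_of_le hm with h | h
        · rw [show i + 1 = 2 * (g + 1) by omega, w_self, mul_one] at *
          exact H c' hc'
        · obtain ⟨b, hb, hcb⟩ := exists_e_mul_e_of_lt hi.1 hmn hc'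
          refine Submodule.mem_sup_left (Submodule.mem_sup_right
            ⟨b, rangeAlg_mono le_rfl (by omega) hb, ?_⟩)
          rw [LinearMap.mulLeft_apply, w_succ (by omega)]
          simp only [mul_assoc] at hcb ⊢
          rw [hcb]
  induction m, hm using Nat.le_induction with
  | base =>
    intro hmn
    refine reduce _ le_rfl hmn fun c hc => Submodule.mem_sup_left (Submodule.mem_sup_left ?_)
    -- Here m = 2g + 1, so the product on the left ends in e_m and absorbs the new e_m.
    obtain ⟨b, hb, hcb⟩ := exists_e_mul_e_of_lt (by omega) hmn hc
    refine ⟨b, rangeAlg_mono le_rfl (by omega) hb, ?_⟩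
    rw [LinearMap.mulLeft_apply, oddProd_succ', zero_add]
    simp only [mul_assoc] at hcb ⊢
    rw [hcb]
  | succ m hm ih =>
    intro hmn
    refine reduce _ (by omega) hmn fun c hc => ?_
    obtain ⟨u', hu', s, hs, hu⟩ := Submodule.mem_sup.1 (ih (by omega) c hc)
    obtain ⟨_, ⟨c₁, hc₁, rfl⟩, _, ⟨c₂, hc₂, rfl⟩, rfl⟩ := Submodule.mem_sup.1 hu'
    have comm : ∀ y ∈ rangeAlg x n 1 m, Commute (e x n (m + 1)) y := fun y hy =>
      commute_of_mem_rangeAlg hy fun i _ h => e_commute (by omega)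
    rw [← hu, add_mul, add_mul]
    refine add_mem (add_mem ?_ ?_) ?_
    · rw [LinearMap.mulLeft_apply, mul_assoc, ← (comm c₁ hc₁).eq, ← mul_assoc]
      -- For m = 2g + 1 the letter e_{m+1} is the whole word w; for larger m it commutes with the
      -- product and lengthens it modulo the sandwich.
      rcases Nat.eq_or_lt_of_le hm with h | h
      · refine Submodule.mem_sup_left (Submodule.mem_sup_right
          ⟨c₁, rangeAlg_mono le_rfl (by omega) hc₁, ?_⟩)
        rw [LinearMap.mulLeft_apply, show 2 * (g + 1) = m + 1 by omega, w_succ le_rfl, w_self,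
          one_mul]
      · refine Submodule.mem_sup_right (mul_mem_sandwich ?_ (rangeAlg_mono le_rfl (by omega) hc₁))
        have := mul_e_mem_sandwich (x := x) (n := n) (P := 2 * (g + 1) + 2 ≤ m + 1 + 1)
          (a := 2 * (g + 1) + 1) (i := m + 1) (N := m + 2) (y := oddProd x n 0 (g + 1)) (by omega)
          (by omega) (by omega) (by omega) (by omega)
          (fun j hj => (oddProd_commute (by omega)).symm)
          (S := rangeAlg x n 1 (m + 2)) (rangeAlg_mono (by omega) le_rfl)
        rw [oddProd_succ', zero_add]
        exact this
    · rw [LinearMap.mulLeft_apply, mul_assoc, ← (comm c₂ hc₂).eq]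
      refine Submodule.mem_sup_left (Submodule.mem_sup_right
        ⟨c₂, rangeAlg_mono le_rfl (by omega) hc₂, ?_⟩)
      rw [LinearMap.mulLeft_apply, w_succ (j := m + 1) (by omega)]
      simp only [mul_assoc]
    · exact Submodule.mem_sup_right (mul_mem_sandwich
        (sandwich_mono (by omega) (rangeAlg_mono le_rfl (by omega)) hs)
        (e_mem_rangeAlg (by omega) (by omega)))

variable (x n) in
/-- The element `v_{𝔱|_k}` in terms of the first entries of the shapes. -/
def vPath (a : ℕ → ℕ) : ℕ → TL K x n
  | 0 => 1
  | k + 1 => if a k = a (k + 1) then vPath a k else w x n (2 * a (k + 1)) (k + 1) * vPath a k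

theorem vRestr_eq_vPath {lam : ℕ × ℕ} (t : Tableau n lam) (k : ℕ) :
    vRestr x t k = vPath x n (fun j => (t.shape j).1) k := by
  induction k with
  | zero => rfl
  | succ k ih => rw [vRestr, vPath, ih]

theorem vPath_congr {a b : ℕ → ℕ} {k : ℕ} (h : ∀ j ≤ k, a j = b j) :
    vPath x n a k = vPath x n b k := by
  induction k with
  | zero => rfl
  | succ k ih =>
    rw [vPath, vPath, ih fun j hj => h j (by omega), h k (by omega), h (k + 1) le_rfl]

/-- `a` is the sequence of first entries of a tableau of shape `(f, m - 2f)`. -/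
structure IsPath (m f : ℕ) (a : ℕ → ℕ) : Prop where
  zero : a 0 = 0
  step : ∀ k < m, a (k + 1) = a k ∨ a (k + 1) = a k + 1
  le : ∀ k ≤ m, 2 * a k ≤ k
  last : a m = f

variable (x n) in
/-- The elements `v_𝔱` for the tableaux of shape `(f, m - 2f)`. -/
def pathSet (m f : ℕ) : Set (TL K x n) := {v | ∃ a, IsPath m f a ∧ v = vPath x n a m}

theorem IsPath.extend {m f f' : ℕ} {a : ℕ → ℕ} (ha : IsPath m f a) (hf : f' = f ∨ f' = f + 1)
    (hm : 2 * f' ≤ m + 1) : IsPath (m + 1) f' fun k => if k ≤ m then a k else f' where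
  zero := by simp [ha.zero]
  step k hk := by
    rcases Nat.lt_or_ge k m with h | h
    · rw [if_pos (by omega), if_pos (by omega)]
      exact ha.step k h
    · obtain rfl : k = m := by omega
      rw [if_neg (by omega), if_pos le_rfl, ha.last]
      exact hf
  le k hk := by
    split_ifs with h
    · exact ha.le k h
    · omega
  last := by simp

theorem mem_pathSet_succ {m f : ℕ} {v : TL K x n} (hv : v ∈ pathSet x n m f) :
    v ∈ pathSet x n (m + 1) f := by
  obtain ⟨a, ha, rfl⟩ := hv
  have h2 := ha.le m le_rfl
  rw [ha.last] at h2
  refine ⟨_, ha.extend (Or.inl rfl) (by omega), ?_⟩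
  rw [vPath, if_pos (by simp [ha.last])]
  exact vPath_congr fun j hj => (if_pos hj).symm

theorem w_mul_mem_pathSet {m g : ℕ} {v : TL K x n} (hv : v ∈ pathSet x n m g)
    (hm : 2 * (g + 1) ≤ m + 1) :
    w x n (2 * (g + 1)) (m + 1) * v ∈ pathSet x n (m + 1) (g + 1) := by
  obtain ⟨a, ha, rfl⟩ := hv
  refine ⟨_, ha.extend (Or.inr rfl) hm, ?_⟩
  rw [vPath, if_neg (by simp [ha.last])]
  congr 1
  · simp
  · exact vPath_congr fun j hj => (if_pos hj).symm

/-- The Murphy elements span the right ideal generated by `e_1 e_3 ⋯ e_{2f-1}`, modulo the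
ideal generated by the longer such products. -/
theorem oddProd_mul_mem_span (hx : x ≠ 0) (m : ℕ) : m ≤ n → ∀ f, 2 * f ≤ m →
    ∀ a ∈ rangeAlg x n 1 m, oddProd x n 0 f * a ∈
      (Submodule.span K (pathSet x n m f)).map (LinearMap.mulLeft K (oddProd x n 0 f))
      ⊔ sandwich (2 * f + 2 ≤ m) (rangeAlg x n 1 m) (oddProd x n 0 (f + 1)) := by
  have zero_case : ∀ m ≤ n, ∀ a ∈ rangeAlg x n 1 m, oddProd x n 0 0 * a ∈
      (Submodule.span K (pathSet x n m 0)).map (LinearMap.mulLeft K (oddProd x n 0 0))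
      ⊔ sandwich (2 * 0 + 2 ≤ m) (rangeAlg x n 1 m) (oddProd x n 0 (0 + 1)) := by
    intro m hm a ha
    have h := oddProd_mul_mul_oddProd (x := x) hm 0 0 (by omega) a ha
    rw [oddProd_zero, mul_one] at h
    rw [oddProd_zero]
    refine SetLike.le_def.1 (sup_le_sup_right ?_ _) h
    rw [Submodule.span_singleton_le_iff_mem]
    refine ⟨1, Submodule.subset_span ⟨fun _ => 0, ⟨rfl, by simp, by simp, rfl⟩, ?_⟩, by simp⟩
    clear hm ha h
    induction m with
    | zero => rfl
    | succ m ih => rw [vPath, if_pos rfl, ← ih]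
  induction m with
  | zero =>
    intro hm f hf
    obtain rfl : f = 0 := by omega
    exact zero_case 0 hm
  | succ m ih =>
    intro hm f hf
    rcases f with _ | g
    · exact zero_case _ hm
    set Z := (Submodule.span K (pathSet x n (m + 1) (g + 1))).map
      (LinearMap.mulLeft K (oddProd x n 0 (g + 1)))
      ⊔ sandwich (2 * (g + 1) + 2 ≤ m + 1) (rangeAlg x n 1 (m + 1)) (oddProd x n 0 (g + 2)) with hZ
    have first : 2 * (g + 1) ≤ m → ∀ c ∈ rangeAlg x n 1 m, oddProd x n 0 (g + 1) * c ∈ Z := by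
      intro h c hc
      refine sup_le_sup (Submodule.map_mono (Submodule.span_mono fun v hv => mem_pathSet_succ hv))
        (sandwich_mono (by omega) (rangeAlg_mono le_rfl (by omega)))
        (ih (by omega) (g + 1) h c hc)
    have second : ∀ c ∈ rangeAlg x n 1 m,
        oddProd x n 0 (g + 1) * w x n (2 * (g + 1)) (m + 1) * c ∈ Z := by
      intro c hc
      obtain ⟨_, ⟨v, hv, rfl⟩, s, hs, hvs⟩ := Submodule.mem_sup.1 (ih (by omega) g (by omega) c hc)
      rw [LinearMap.mulLeft_apply] at hvs
      -- As a difference of left multiples of e_1 ⋯ e_{2g-1}, the error s is fixed by this product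
      -- up to x^g. Since x ≠ 0, the product can be pulled out of s and traded back for e_1 ⋯
      -- e_{2g+1} w.
      have hms : oddProd x n 0 g * s = x ^ g • s := by
        rw [← sub_eq_of_eq_add' hvs.symm, mul_sub, ← mul_assoc, ← mul_assoc,
          oddProd_mul_self (by omega), smul_mul_assoc, smul_mul_assoc, smul_sub]
      have hs2 : s = oddProd x n 0 g * ((x ^ g)⁻¹ • s) := by
        rw [mul_smul_comm, hms, smul_smul, inv_mul_cancel₀ (pow_ne_zero g hx), one_smul]
      rw [oddProd_mul_w (by omega), mul_assoc, ← hvs, mul_add (w x n _ _), hs2, ← mul_assoc,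
        ← mul_assoc, ← oddProd_mul_w (by omega)]
      refine add_mem ?_ ?_
      · refine Submodule.mem_sup_left ?_
        have : Submodule.span K (pathSet x n m g) ≤
            (Submodule.span K (pathSet x n (m + 1) (g + 1))).comap
              (LinearMap.mulLeft K (w x n (2 * (g + 1)) (m + 1))) := by
          refine Submodule.span_le.2 fun v hv => ?_
          exact Submodule.subset_span (w_mul_mem_pathSet hv hf)
        exact ⟨_, this hv, by simp [mul_assoc]⟩
      · rw [mul_smul_comm]
        refine Submodule.smul_mem _ _ ?_
        have hle : sandwich (2 * g + 2 ≤ m) (rangeAlg x n 1 m) (oddProd x n 0 (g + 1)) ≤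
            Z.comap (LinearMap.mulLeft K
              (oddProd x n 0 (g + 1) * w x n (2 * (g + 1)) (m + 1))) := by
          refine sandwich_le fun hP a ha b hb => ?_
          rw [Submodule.mem_comap, LinearMap.mulLeft_apply]
          -- The error now contains e_1 ⋯ e_{2g+1} twice; squeezing what lies between leaves a
          -- multiple of one copy, handled by `first`, modulo longer products.
          have h := oddProd_mul_mul_oddProd (x := x) hm (g + 1) 0 (by omega)
            (w x n (2 * (g + 1)) (m + 1) * a)
            (mul_mem (w_mem (by omega) le_rfl) (rangeAlg_mono le_rfl (by omega) ha))
          obtain ⟨y, hy, s', hs', hys⟩ := Submodule.mem_sup.1 h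
          obtain ⟨c', rfl⟩ := Submodule.mem_span_singleton.1 hy
          have e1 : oddProd x n 0 (g + 1) * w x n (2 * (g + 1)) (m + 1)
              * (a * oddProd x n 0 (g + 1) * b)
              = oddProd x n 0 (g + 1) * (w x n (2 * (g + 1)) (m + 1) * a)
                * oddProd x n 0 (g + 1) * b := by simp only [mul_assoc]
          rw [e1, ← hys, add_mul, smul_mul_assoc]
          refine add_mem (Submodule.smul_mem _ _ (first (by omega) b hb))
            (Submodule.mem_sup_right (mul_mem_sandwich ?_ (rangeAlg_mono le_rfl (by omega) hb)))
          simpa only [zero_add] using hs'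
        exact hle hs
    intro a ha
    obtain ⟨u', hu', s, hs, hu⟩ := Submodule.mem_sup.1
      (oddProd_mul_mem (g := g) (m := m) (by omega) hm a ha)
    obtain ⟨_, ⟨c₁, hc₁, rfl⟩, _, ⟨c₂, hc₂, rfl⟩, rfl⟩ := Submodule.mem_sup.1 hu'
    rw [← hu]
    refine add_mem (add_mem ?_ (second c₂ hc₂)) (Submodule.mem_sup_right hs)
    rcases Nat.lt_or_ge m (2 * (g + 1)) with h | h
    · have := second c₁ hc₁
      rwa [show m + 1 = 2 * (g + 1) by omega, w_self, mul_one] at this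
    · exact first h c₁ hc₁

theorem rangeAlg_eq_top : rangeAlg x n 1 n = ⊤ := by
  have h := FreeAlgebra.adjoin_range_ι K (GenIdx n)
  have hs : Function.Surjective (RingQuot.mkAlgHom K (Rel K x n)) :=
    RingQuot.mkAlgHom_surjective K _
  rw [eq_top_iff, ← (AlgHom.range_eq_top _).2 hs, ← Algebra.map_top, ← h, AlgHom.map_adjoin]
  refine Algebra.adjoin_mono ?_
  rintro _ ⟨_, ⟨i, rfl⟩, rfl⟩
  exact ⟨i.1, i.2, by rw [e, dif_pos i.2]⟩

theorem mPart_eq_oddProd (lam : ℕ × ℕ) : mPart x n lam = oddProd x n 0 lam.1 := by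
  rw [mPart, oddProd, List.range_eq_range']

theorem cellModule_le_span (hx : x ≠ 0) {lam : ℕ × ℕ} (hlam : 2 * lam.1 + lam.2 = n) :
    cellModule x n lam ≤ Submodule.span K (Set.range fun t : Tableau n lam => mTab x t) := by
  rintro _ ⟨q, rfl⟩
  obtain ⟨a, rfl⟩ : ∃ a, toQuot x n lam a = q := RingCon.mk'_surjective _ q
  rw [LinearMap.mulLeft_apply, ← map_mul, mPart_eq_oddProd]
  have h := oddProd_mul_mem_span hx n le_rfl lam.1 (by omega) a
    (by rw [rangeAlg_eq_top]; exact Algebra.mem_top)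
  let π : TL K x n →ₗ[K] TLQuot x n lam :=
    (RingCon.mkₐ K (higherIdeal x n lam).ringCon).toLinearMap
  change π _ ∈ _
  have hle : (Submodule.span K (pathSet x n n lam.1)).map
        (LinearMap.mulLeft K (oddProd x n 0 lam.1))
      ⊔ sandwich (2 * lam.1 + 2 ≤ n) (rangeAlg x n 1 n) (oddProd x n 0 (lam.1 + 1))
      ≤ (Submodule.span K (Set.range fun t : Tableau n lam => mTab x t)).comap π := by
    refine sup_le ?_ (sandwich_le fun hP a _ b _ => ?_)
    · rw [Submodule.map_le_iff_le_comap, Submodule.span_le]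
      rintro _ ⟨f, hf, rfl⟩
      refine Submodule.subset_span ?_
      let t : Tableau n lam := Tableau.ofBoxes (fun k => k - 2 * f k) (by simp)
        (by
          intro k hk
          have h1 := hf.le k hk.le
          have h2 := hf.le (k + 1) hk
          have h3 := hf.step k hk
          omega) (by simp only [hf.last]; omega) hlam
      refine ⟨t, ?_⟩
      have ht : vPath x n f n = vRestr x t n := by
        rw [vRestr_eq_vPath]
        refine vPath_congr fun j hj => ?_
        have h1 := t.shape_weight hj
        have h2 : t.boxes j = j - 2 * f j := Tableau.boxes_ofBoxes _ _ _ _ _ hj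
        have h3 := hf.le j hj
        omega
      rw [ht]
      change mTab x t = toQuot x n lam (oddProd x n 0 lam.1 * vRestr x t n)
      rw [mTab, mPart_eq_oddProd]
    · rw [Submodule.mem_comap]
      have : π (a * oddProd x n 0 (lam.1 + 1) * b) = 0 := by
        have hmem : oddProd x n 0 (lam.1 + 1) ∈ higherIdeal x n lam := by
          refine TwoSidedIdeal.subset_span ⟨(lam.1 + 1, n - 2 * (lam.1 + 1)), ?_, by simp,
            by rw [mPart_eq_oddProd]⟩
          unfold partitions
          exact Finset.mem_image.2 ⟨lam.1 + 1, Finset.mem_range.2 (by omega), rfl⟩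
        have h2 := (higherIdeal x n lam).mul_mem_right _ b
          ((higherIdeal x n lam).mul_mem_left a _ hmem)
        rw [TwoSidedIdeal.mem_iff] at h2
        exact (RingCon.eq _).2 h2
      rw [this]
      exact Submodule.zero_mem _
  exact hle h

end Spanning

/-! ### The seminormal basis -/

section Basis

variable {K : Type} [Field K] {x : K} {n : ℕ} {lam : ℕ × ℕ}

theorem fTab_eq (t : Tableau n lam) :
    fTab x t = toQuot x n lam (mPart x n lam * vRestr x t n * idem x t) := by
  rw [fTab, mTab, map_mul (toQuot x n lam) (_ * _)]

theorem toQuot_smul (c : K) (a : TL K x n) : toQuot x n lam (c • a) = c • toQuot x n lam a := rfl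

/-- The coefficients of a combination of the `f_s` can be read off in the seminormal
representation. -/
theorem seminormalRep_apply_of_toQuot_eq (hp : ∀ j, p x (j + 1) ≠ 0)
    (hlam : 2 * lam.1 + lam.2 = n) {a : TL K x n} {c : Tableau n lam → K}
    (h : toQuot x n lam a = ∑ s, c s • fTab x s) (φ : Tableau n lam → K) :
    seminormalRep hp lam a φ (topTableau hlam) = x ^ lam.1 * ∑ s, c s * φ s := by
  have h1 : toQuot x n lam a = toQuot x n lam
      (∑ s : Tableau n lam, c s • (mPart x n lam * vRestr x s n * idem x s)) := by
    rw [h, map_sum]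
    refine Finset.sum_congr rfl fun s _ => ?_
    rw [toQuot_smul, fTab_eq]
  have h2 : a - ∑ s : Tableau n lam, c s • (mPart x n lam * vRestr x s n * idem x s)
      ∈ higherIdeal x n lam := by
    rw [TwoSidedIdeal.mem_iff]
    exact (RingCon.eq _).1 (show toQuot x n lam _ = 0 by rw [map_sub, h1, sub_self])
  have h3 := seminormalRep_eq_zero_of_mem hp h2
  rw [map_sub, sub_eq_zero, map_sum] at h3
  rw [h3, LinearMap.sum_apply, Finset.sum_apply, Finset.mul_sum]
  refine Finset.sum_congr rfl fun s _ => ?_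
  rw [map_smul, LinearMap.smul_apply, Pi.smul_apply, seminormalRep_murphy_apply hp hlam,
    smul_eq_mul]
  ring

theorem linearIndependent_fTab (hp : ∀ j, p x (j + 1) ≠ 0) (hlam : 2 * lam.1 + lam.2 = n) :
    LinearIndependent K fun t : Tableau n lam => fTab x t := by
  classical
  have hx : x ≠ 0 := by rw [← p_two x]; exact hp 1
  rw [Fintype.linearIndependent_iff]
  intro c hc t
  have h := seminormalRep_apply_of_toQuot_eq hp hlam (a := 0) (c := c) (by rw [hc, map_zero])
    (Pi.single t 1)
  rw [map_zero, LinearMap.zero_apply, Pi.zero_apply, eq_comm,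
    mul_eq_zero_iff_left (pow_ne_zero _ hx)] at h
  simpa [Pi.single_apply] using h

theorem fTab_mem_cellModule (t : Tableau n lam) : fTab x t ∈ cellModule x n lam :=
  ⟨toQuot x n lam (vRestr x t n * idem x t), by
    rw [LinearMap.mulLeft_apply, ← map_mul, fTab_eq, mul_assoc]⟩

/-- The cell module lies in the span of the m_t, so its dimension is at most the number of tableaux,
while the f_t are that many independent elements of it. -/
theorem span_fTab (hp : ∀ j, p x (j + 1) ≠ 0) (hlam : 2 * lam.1 + lam.2 = n) :
    Submodule.span K (Set.range fun t : Tableau n lam => fTab x t) = cellModule x n lam := by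
  have hx : x ≠ 0 := by rw [← p_two x]; exact hp 1
  have hle := cellModule_le_span hx hlam
  have fd : FiniteDimensional K
      (Submodule.span K (Set.range fun t : Tableau n lam => mTab x t)) :=
    FiniteDimensional.span_of_finite K (Set.finite_range _)
  have fd' : FiniteDimensional K (cellModule x n lam) := Submodule.finiteDimensional_of_le hle
  refine Submodule.eq_of_le_of_finrank_le ?_ ?_
  · rw [Submodule.span_le]
    rintro _ ⟨t, rfl⟩
    exact fTab_mem_cellModule t
  · rw [finrank_span_eq_card (linearIndependent_fTab hp hlam)]
    exact (Submodule.finrank_mono hle).trans (finrank_range_le_card _)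

open Classical in
/-- The coefficient of `f_s` in `f_t e_k`. -/
def entry (x : K) (k : ℕ) (s t : Tableau n lam) : K := seminormalOp x n lam k (Pi.single s 1) t

theorem fTab_mul_e (hp : ∀ j, p x (j + 1) ≠ 0) (hlam : 2 * lam.1 + lam.2 = n) {k : ℕ}
    (hk : 1 ≤ k) (hkn : k < n) (t : Tableau n lam) :
    fTab x t * toQuot x n lam (e x n k) = ∑ s, entry x k s t • fTab x s := by
  classical
  have hx : x ≠ 0 := by rw [← p_two x]; exact hp 1
  have hmem : fTab x t * toQuot x n lam (e x n k)
      ∈ Submodule.span K (Set.range fun t : Tableau n lam => fTab x t) := by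
    rw [span_fTab hp hlam]
    obtain ⟨q, hq⟩ := fTab_mem_cellModule (x := x) t
    refine ⟨q * toQuot x n lam (e x n k), ?_⟩
    rw [← hq, LinearMap.mulLeft_apply, LinearMap.mulLeft_apply, mul_assoc]
  obtain ⟨c, hc⟩ := (Submodule.mem_span_range_iff_exists_fun K).1 hmem
  rw [← hc]
  refine Finset.sum_congr rfl fun s _ => ?_
  congr 1
  rw [fTab_eq, ← map_mul] at hc
  -- Testing against the indicator of s isolates the coefficient of f_s; both sides carry the factor
  -- x^f.
  have h := seminormalRep_apply_of_toQuot_eq hp hlam hc.symm (Pi.single s 1)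
  rw [map_mul, Module.End.mul_apply, seminormalRep_murphy_apply hp hlam,
    seminormalRep_e hp lam hk hkn] at h
  have h' := mul_left_cancel₀ (pow_ne_zero _ hx) h
  rw [entry, h']
  simp [Pi.single_apply]

/-! ### The matrix entries and their eigenvalue formulas -/

section Entries

variable {k : ℕ} {s t : Tableau n lam}

theorem entry_eq_zero_of_not_turns (ht : ¬ t.Turns k) : entry x k s t = 0 :=
  seminormalOp_of_not_turns ht _

theorem agreeOff_of_entry_ne_zero (hk : 1 ≤ k) (hkn : k < n) (h : entry x k s t ≠ 0) :
    t.Turns k ∧ AgreeOff k s t := by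
  classical
  have ht : t.Turns k := by
    by_contra ht
    exact h (entry_eq_zero_of_not_turns ht)
  refine ⟨ht, ?_⟩
  rw [entry, seminormalOp_of_turns ht, average, Pi.single_apply, Pi.single_apply] at h
  by_cases h1 : t.peak k = s
  · rw [← h1]; exact agreeOff_peak hk hkn ht
  · by_cases h2 : t.valley k = s
    · rw [← h2]
      refine agreeOff_valley hk hkn ht fun h0 => h ?_
      rw [if_neg h1, h0, p_zero]
      simp
    · rw [if_neg h1, if_neg h2] at h
      simp at h

/-- Dominance compares first entries, and 2i plus the number of boxes is k, so the dominant tableau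
is the lower path. -/
theorem boxes_lt_of_strictlyDominates (ha : AgreeOff k s t) (hk : 1 ≤ k) (hkn : k < n)
    (h : t.StrictlyDominates s) : t.boxes k < s.boxes k := by
  have h1 := h.1 k hk hkn.le
  have w1 := s.shape_weight hkn.le
  have w2 := t.shape_weight hkn.le
  rcases Nat.lt_or_ge (t.boxes k) (s.boxes k) with h2 | h2
  · exact h2
  · exact absurd (Tableau.eq_of_boxes_of_ne k ha (by omega)).symm h.2

/-- A pair `𝔱 ▷ 𝔰` agreeing off level `k` consists of a valley and a peak. -/
theorem valley_and_peak (ha : AgreeOff k s t) (hk : 1 ≤ k) (hkn : k < n)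
    (h : t.StrictlyDominates s) :
    t.boxes (k - 1) = t.boxes k + 1 ∧ s.boxes k = t.boxes (k - 1) + 1 := by
  have h1 := boxes_lt_of_strictlyDominates ha hk hkn h
  have h2 := s.boxes_pred hk hkn.le
  have h3 := t.boxes_pred hk hkn.le
  have h4 := ha (k - 1) (by omega) (by omega)
  omega

/-- The matrix entries of a block. -/
theorem entry_block (ha : AgreeOff k s t) (hk : 1 ≤ k) (hkn : k < n) (ht : t.Turns k)
    (h : t.StrictlyDominates s) :
    entry x k s t = 1 ∧
    entry x k t t = p x (t.boxes (k - 1)) / p x (t.boxes (k - 1) + 1) ∧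
    entry x k s s = p x (t.boxes (k - 1) + 2) / p x (t.boxes (k - 1) + 1) ∧
    entry x k t s = p x (t.boxes (k - 1) + 2) / p x (t.boxes (k - 1) + 1)
      * (p x (t.boxes (k - 1)) / p x (t.boxes (k - 1) + 1)) := by
  classical
  obtain ⟨hv, hpk⟩ := valley_and_peak ha hk hkn h
  have e1 : t = t.valley k := Tableau.eq_valley hk hkn ht (fun _ _ _ => rfl) hv
  have e2 : s = t.peak k := Tableau.eq_peak hk hkn ht ha hpk
  have hne : s ≠ t := h.2.symm
  have a1 : average x k (Pi.single s 1) t = 1 := by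
    rw [average, ← e1, ← e2, Pi.single_eq_same, Pi.single_eq_of_ne hne.symm, mul_zero, add_zero]
  have a2 : average x k (Pi.single t 1) t = p x (t.boxes (k - 1)) / p x (t.boxes (k - 1) + 1) := by
    rw [average, ← e1, ← e2, Pi.single_eq_same, Pi.single_eq_of_ne hne, mul_one, zero_add]
  have w1 : weight x t k = 1 := if_neg (by omega)
  refine ⟨?_, ?_, ?_, ?_⟩
  · rw [entry, seminormalOp_of_turns ht, w1, a1, mul_one]
  · rw [entry, seminormalOp_of_turns ht, w1, a2, one_mul]
  · have := seminormalOp_peak (x := x) hk hkn ht (Pi.single s 1)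
    rw [← e2, a1, mul_one] at this
    exact this
  · have := seminormalOp_peak (x := x) hk hkn ht (Pi.single t 1)
    rw [← e2, a2] at this
    exact this

/-- Tableaux agreeing off level k differ only in their height there, which can be only h + 1 or h -
1; there is no room for a third. -/
theorem entry_eq_zero_of_block {u : Tableau n lam} (hk : 1 ≤ k) (hkn : k < n)
    (hs : entry x k s t ≠ 0) (hst : s ≠ t) (hus : u ≠ s) (hut : u ≠ t) : entry x k u t = 0 := by
  by_contra hu
  obtain ⟨-, as⟩ := agreeOff_of_entry_ne_zero hk hkn hs
  obtain ⟨-, au⟩ := agreeOff_of_entry_ne_zero hk hkn hu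
  have n1 : s.boxes k ≠ t.boxes k := fun h => hst (Tableau.eq_of_boxes_of_ne k as h)
  have n2 : u.boxes k ≠ t.boxes k := fun h => hut (Tableau.eq_of_boxes_of_ne k au h)
  have n3 : u.boxes k ≠ s.boxes k := fun h => hus (Tableau.eq_of_boxes_of_ne k
    (fun j hj hjk => by rw [au j hj hjk, as j hj hjk]) h)
  have h1 := t.boxes_pred hk hkn.le
  have h2 := s.boxes_pred hk hkn.le
  have h3 := u.boxes_pred hk hkn.le
  have h4 := as (k - 1) (by omega) (by omega)
  have h5 := au (k - 1) (by omega) (by omega)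
  omega

theorem r_eq_of_agreeOff (ha : AgreeOff k s t) {j : ℕ} (hj : j ≤ n) (hjk : j ≠ k)
    (hjk' : j ≠ k + 1) : r x s j = r x t j := by
  unfold r
  split_ifs with h
  · rfl
  · rw [ha.shape_eq hj hjk, ha.shape_eq (j := j - 1) (by omega) (by omega)]

/-- The diagonal entries at a valley, in terms of the eigenvalues. -/
theorem valley_eq_div (hk : 1 ≤ k) (hkn : k < n) (ht : t.Turns k)
    (h : t.boxes (k - 1) = t.boxes k + 1) :
    p x (t.boxes (k - 1)) / p x (t.boxes (k - 1) + 1) = (r x t (k + 1) + z x t (k - 1))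
      / (p x k - x * z x t (k - 1) - 2 * r x t k) := by
  have h1 := r_down_sub_r_up x (t.shape (k - 1)).1 (t.boxes (k - 1))
  have h2 := r_down_add_r_up x (t.shape (k - 1)).1 (t.boxes (k - 1))
  have h3 := t.shape_weight (k := k - 1) (by omega)
  -- The denominator is r_up + r_down - 2 r_t(k) with r_t(k) = r_down at a valley, that is r_up -
  -- r_down.
  have hd : p x k - x * z x t (k - 1) - 2 * r x t k = - p x (t.boxes (k - 1) + 1) := by
    rw [z_eq x t (by omega), r_of_down x t hk hkn.le h, ← h1]
    rw [h3, Nat.sub_add_cancel hk] at h2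
    linear_combination -h2
  rw [hd, r_succ_add_z_of_valley x t hk hkn ht h, neg_div_neg_eq]

/-- The diagonal entries at a peak, in terms of the eigenvalues. -/
theorem peak_eq_div (hk : 1 ≤ k) (hkn : k < n) (ht : t.Turns k)
    (h : t.boxes k = t.boxes (k - 1) + 1) :
    p x (t.boxes (k - 1) + 2) / p x (t.boxes (k - 1) + 1) = (r x t (k + 1) + z x t (k - 1))
      / (p x k - x * z x t (k - 1) - 2 * r x t k) := by
  have h1 := r_down_sub_r_up x (t.shape (k - 1)).1 (t.boxes (k - 1))
  have h2 := r_down_add_r_up x (t.shape (k - 1)).1 (t.boxes (k - 1))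
  have h3 := t.shape_weight (k := k - 1) (by omega)
  have hd : p x k - x * z x t (k - 1) - 2 * r x t k = p x (t.boxes (k - 1) + 1) := by
    rw [z_eq x t (by omega), r_of_up x t hk hkn.le h, ← h1]
    rw [h3, Nat.sub_add_cancel hk] at h2
    linear_combination -h2
  rw [hd, r_succ_add_z_of_peak x t hk hkn ht h]

end Entries

theorem weight_of_mem_partitions (hlam : lam ∈ partitions n) : 2 * lam.1 + lam.2 = n := by
  unfold partitions at hlam
  obtain ⟨i, hi, rfl⟩ := Finset.mem_image.1 hlam
  rw [Finset.mem_range] at hi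
  simp only
  omega

end Basis

end TemperleyLieb
end

open TemperleyLieb in
theorem mainTheorem7 (n : ℕ) (lam : ℕ × ℕ) (hlam : lam ∈ partitions n) :
    -- the `f_𝔱` form a basis of the cell module, so that the matrix entries `E s t = e_k(𝔰, 𝔱)`
    -- below are well defined
    LinearIndependent FracField (fun t : Tableau n lam => fTab gx t) ∧
    Submodule.span FracField (Set.range fun t : Tableau n lam => fTab gx t)
      = cellModule gx n lam ∧
    ∀ k : ℕ, 1 ≤ k → k < n →
      ∃ E : Tableau n lam → Tableau n lam → FracField,
        (∀ t, fTab gx t * toQuot gx n lam (e gx n k) = ∑ s, E s t • fTab gx s) ∧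
        -- the two tableaux agree away from step `k`
        (∀ s t, E s t ≠ 0 →
          (∀ j, j ≤ n → j ≠ k → s.shape j = t.shape j) ∧
          (∀ j, j ≤ n → j ≠ k → j ≠ k + 1 → r gx s j = r gx t j)) ∧
        -- both return at step `k + 1` to the diagram of step `k - 1`
        (∀ s t, E s t ≠ 0 →
          t.boxes (k - 1) = t.boxes (k + 1) ∧ s.boxes (k - 1) = s.boxes (k + 1)) ∧
        (∀ s t, E s t ≠ 0 → s ≠ t → ∀ u, u ≠ s → u ≠ t → E u t = 0) ∧
        -- the block of a pair `𝔱 ▷ 𝔰`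
        (∀ s t, t.StrictlyDominates s → E s t ≠ 0 →
          E s t = 1 ∧
          E t t = (r gx t (k + 1) + z gx t (k - 1))
            / (p gx k - gx * z gx t (k - 1) - 2 * r gx t k) ∧
          E s s = (r gx s (k + 1) + z gx s (k - 1))
            / (p gx k - gx * z gx s (k - 1) - 2 * r gx s k) ∧
          E t s = E s s * E t t ∧
          ∀ i, t.shape k = (i, k - 2 * i) →
            E t t = p gx (k - 2 * i + 1) / p gx (k - 2 * i + 2) ∧
            E s s = p gx (k - 2 * i + 3) / p gx (k - 2 * i + 2)) ∧
        -- every pair `𝔱 ▷ 𝔰` satisfying the two necessary conditions does give such a block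
        (∀ s t, t.StrictlyDominates s → (∀ j, j ≤ n → j ≠ k → s.shape j = t.shape j) →
          t.boxes (k - 1) = t.boxes (k + 1) → E s t ≠ 0) := by
  have hw := weight_of_mem_partitions hlam
  refine ⟨linearIndependent_fTab p_gx_ne_zero hw, span_fTab p_gx_ne_zero hw, fun k hk hkn =>
    ⟨entry gx k, fTab_mul_e p_gx_ne_zero hw hk hkn, fun s t h => ?_, fun s t h => ?_,
      fun s t h hst u hus hut => entry_eq_zero_of_block hk hkn h hst hus hut, fun s t hd h => ?_,
      fun s t hd ha ht => ?_⟩⟩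
  · have ha := (agreeOff_of_entry_ne_zero hk hkn h).2
    exact ⟨fun j hj hjk => ha.shape_eq hj hjk, fun j hj h1 h2 => r_eq_of_agreeOff ha hj h1 h2⟩
  · obtain ⟨ht, ha⟩ := agreeOff_of_entry_ne_zero hk hkn h
    exact ⟨ht, ha.turns hk hkn ht⟩
  · obtain ⟨ht, ha⟩ := agreeOff_of_entry_ne_zero hk hkn h
    obtain ⟨h1, h2, h3, h4⟩ := entry_block (x := gx) ha hk hkn ht hd
    obtain ⟨hv, hpk⟩ := valley_and_peak ha hk hkn hd
    have hb := ha (k - 1) (by omega) (by omega)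
    refine ⟨h1, ?_, ?_, ?_, fun i hi => ?_⟩
    · rw [h2, valley_eq_div hk hkn ht hv]
    · rw [h3, ← hb, peak_eq_div hk hkn (ha.turns hk hkn ht) (by rw [hpk, hb])]
    · rw [h4, h3, h2]
    -- Since t is the valley, the common height at level k - 1 is h = k - 2i + 1, which turns p_h,
    -- p_{h+1}, p_{h+2} into the stated indices.
    · have hbk : t.boxes k = k - 2 * i := by rw [Tableau.boxes, hi]
      rw [h2, h3, hv, hbk]
      exact ⟨rfl, rfl⟩
  · have ha' : AgreeOff k s t := fun j hj hjk => congrArg Prod.snd (ha j hj hjk)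
    rw [(entry_block (x := gx) ha' hk hkn ht hd).1]
    exact one_ne_zero
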